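/- For a nonempty bounded set $K\subset\mathbb R^2$ let $K^*=\{\xi\in\mathbb R^2:\sup_{x\in K}x\cdot\xi\le 1\}$, and write $\|z\|_{K^*}=\inf\{r>0: z\in rK^*\}$ and $\Delta_{K^*}(E)=\{\|x-y\|_{K^*}:x,y\in E\}$. **Theorem.** Let $K\subset\mathbb R^2$ be a bounded convex set with the origin in its interior (for example, a bounded convex set with nonempty interior that is symmetric about the origin), whose boundary $\partial K$ is a $C^\infty$ curve with everywhere nonvanishing curvature. Let $E\subset[0,1]^2$, and let $\mu$ be a nonzero finite Borel measure on $\mathbb R^2$ carried by $E$, that is, $\mu(\mathbb R^2\setminus E)=0$. Put $\widehat\mu(\xi)=\int e^{-2\pi i x\cdot\xi}\,d\mu(x)$, and let $d\omega_K$ denote arc length on $\partial K$. If $$\int_1^\infty\left(\int_{\partial K}|\widehat\mu(t\omega_K)|^2\,d\omega_K\right)^2 t\,dt<\infty,$$ then $\Delta_{K^*}(E)$ has positive Lebesgue measure (positive outer measure, if $\Delta_{K^*}(E)$ is not measurable). -/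

import Mathlib

open MeasureTheory Set
open scoped ContDiff

noncomputable section

/-- The Euclidean plane. -/
abbrev Plane : Type := EuclideanSpace ℝ (Fin 2)

/-- The Fourier transform `μ̂(ξ) = ∫ e^{-2π i x · ξ} dμ(x)` of a measure on the plane. -/
def fourierMeasure (μ : Measure Plane) (ξ : Plane) : ℂ :=
  ∫ x, Complex.exp (((-(2 * Real.pi * inner ℝ x ξ) : ℝ) : ℂ) * Complex.I) ∂μ

/-- The signed curvature `(γ₁' γ₂'' - γ₂' γ₁'') / |γ'|³` of a parametrized plane curve. -/
def curveCurvature (γ : ℝ → Plane) (s : ℝ) : ℝ :=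
  (deriv γ s 0 * deriv (deriv γ) s 1 - deriv γ s 1 * deriv (deriv γ) s 0) / ‖deriv γ s‖ ^ 3

/-- The planar set `C` is a smooth closed curve with everywhere nonvanishing curvature: it has a
periodic regular `C^∞` parametrization, injective on a period, whose curvature is never zero. -/
def IsSmoothCurvedClosedCurve (C : Set Plane) : Prop :=
  ∃ (L : ℝ) (γ : ℝ → Plane), 0 < L ∧ ContDiff ℝ ∞ γ ∧ Function.Periodic γ L ∧
    InjOn γ (Ico 0 L) ∧ range γ = C ∧ (∀ s, deriv γ s ≠ 0) ∧ ∀ s, curveCurvature γ s ≠ 0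

/-- The dual set `K* = {ξ : sup_{x ∈ K} x · ξ ≤ 1}`. -/
def dualSet (K : Set Plane) : Set Plane :=
  {ξ | ∀ x ∈ K, inner ℝ x ξ ≤ 1}

/-- The distance set `{‖x - y‖_B : x, y ∈ E}`, where `‖·‖_B` is the gauge (Minkowski functional)
of `B`. -/
def distanceSet (B E : Set Plane) : Set ℝ :=
  {r | ∃ x ∈ E, ∃ y ∈ E, r = gauge B (x - y)}

/-- The integral `∫_1^∞ (∫_{∂K} |μ̂(t w)|² dw)² t dt`, valued in `[0, ∞]`, where `dw` is arc length
(one-dimensional Hausdorff measure) on `∂K`. -/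
def mattilaIntegral (K : Set Plane) (μ : Measure Plane) : ENNReal :=
  ∫⁻ t in Ioi (1 : ℝ),
    (∫⁻ w in frontier K, ‖fourierMeasure μ (t • w)‖ₑ ^ 2 ∂(Measure.hausdorffMeasure 1)) ^ 2 *
      ENNReal.ofReal t

end

/-! Let `ν` be the image of `μ × μ` under `(x, y) ↦ ‖x - y‖_{K*}`. The core is the bound `ν(V) ≤ A
√ε` for open `V ⊆ (r, ∞)` of measure at most `ε`, with `r > 0` fixed and `ε` small
(`exists_measure_le_sqrt`). If the distance set were null, it would lie in open sets of arbitrarily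
small measure, so `ν` would vanish on `(0, ∞)`. Then `μ × μ` lives on the diagonal, `μ` is a point
mass, `|μ̂|` is constant, and the Mattila integral diverges.

The bound rests on a half derivative instead of asymptotics for the Fourier transform of arc length.
Take `f` smooth, `0 ≤ f ≤ 1`, supported in `V`. The symbol of `halfDeriv` is a square root of `π (1
+ 2πit)`, and `halfDeriv f` at `s` sees only values of `f` to the left of `s`. Integrate `halfDeriv
f (w · z)` over `w ∈ ∂K` with respect to the angle of the outer normal. On the curve, `w · z` folds
at its maximum, which is `‖z‖_{K*}`, and at its minimum, which is negative, where `halfDeriv f`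
vanishes. Nonzero curvature makes the upper fold quadratic, so the integration there acts like a
half integral and undoes the half derivative. This gives the pointwise bound `∫ halfDeriv f (w · z)
≥ a f(‖z‖_{K*}) - B √ε` (`exists_integral_halfDeriv_ge`).

Put `z = x - y` and integrate against `μ × μ`. Fourier inversion turns the left side into the
integral of `G(t) |μ̂(tw)|²` over `t` and `w`. Cauchy–Schwarz in `t` with weight `1 + 2π|t|` bounds
it by `‖f‖₂ ≤ √ε` times a constant that the Mattila integral controls (`exists_energy_le`).
Comparing the two bounds yields the estimate for `ν`. -/

open scoped FourierTransform SchwartzMap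

/-! ### Parametrization of the boundary by the normal angle -/

/-- The tangent of a regular plane curve, written in polar form with the angle `ψ` obtained by
integrating curvature. -/
lemma tangent_eq_polar {x1 y1 x2 y2 ψ κ : ℝ → ℝ}
    (hx : ∀ s, HasDerivAt x1 (x2 s) s) (hy : ∀ s, HasDerivAt y1 (y2 s) s)
    (hψ : ∀ s, HasDerivAt ψ (κ s) s)
    (hreg : ∀ s, 0 < x1 s ^ 2 + y1 s ^ 2)
    (hκ : ∀ s, κ s * (x1 s ^ 2 + y1 s ^ 2) = x1 s * y2 s - y1 s * x2 s)
    (hx0 : x1 0 = -√(x1 0 ^ 2 + y1 0 ^ 2) * Real.sin (ψ 0))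
    (hy0 : y1 0 = √(x1 0 ^ 2 + y1 0 ^ 2) * Real.cos (ψ 0)) (s : ℝ) :
    x1 s = -√(x1 s ^ 2 + y1 s ^ 2) * Real.sin (ψ s) ∧
      y1 s = √(x1 s ^ 2 + y1 s ^ 2) * Real.cos (ψ s) := by
  set v : ℝ → ℝ := fun s => √(x1 s ^ 2 + y1 s ^ 2) with hv
  have hvpos : ∀ s, 0 < v s := fun s => Real.sqrt_pos.2 (hreg s)
  have hvsq : ∀ s, v s ^ 2 = x1 s ^ 2 + y1 s ^ 2 := fun s => Real.sq_sqrt (hreg s).le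
  have hvd : ∀ s, HasDerivAt v ((x1 s * x2 s + y1 s * y2 s) / v s) s := by
    intro s
    have h := (((hx s).pow 2).add ((hy s).pow 2)).sqrt (hreg s).ne'
    refine h.congr_deriv ?_
    have : √(x1 s ^ 2 + y1 s ^ 2) = v s := rfl
    simp only [Pi.add_apply, Pi.pow_apply, this]
    have := (hvpos s).ne'
    field_simp
    push_cast
    ring
  have key : ∀ s, x2 s * v s ^ 2 = (x1 s * x2 s + y1 s * y2 s) * x1 s - κ s * v s ^ 2 * y1 s ∧
      y2 s * v s ^ 2 = (x1 s * x2 s + y1 s * y2 s) * y1 s + κ s * v s ^ 2 * x1 s := by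
    intro s
    rw [hvsq, hκ]
    constructor <;> ring
  -- The unit tangent has constant components in the frame `(cos ψ, sin ψ)`, `(-sin ψ, cos ψ)`,
  -- because the frame turns at the same rate `κ` as the tangent.
  have hc1 : ∀ s, HasDerivAt
      (fun s => (x1 s * Real.cos (ψ s) + y1 s * Real.sin (ψ s)) / v s) 0 s := by
    intro s
    have h := ((((hx s).mul (hψ s).cos).add ((hy s).mul (hψ s).sin))).div (hvd s) (hvpos s).ne'
    refine h.congr_deriv ?_
    have h0 := (hvpos s).ne'
    obtain ⟨k1, k2⟩ := key s
    rw [div_eq_zero_iff]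
    left
    simp only [Pi.add_apply, Pi.mul_apply]
    field_simp
    linear_combination (Real.cos (ψ s)) * k1 + (Real.sin (ψ s)) * k2
  have hc2 : ∀ s, HasDerivAt
      (fun s => (y1 s * Real.cos (ψ s) - x1 s * Real.sin (ψ s)) / v s) 0 s := by
    intro s
    have h := ((((hy s).mul (hψ s).cos).sub ((hx s).mul (hψ s).sin))).div (hvd s) (hvpos s).ne'
    refine h.congr_deriv ?_
    have h0 := (hvpos s).ne'
    obtain ⟨k1, k2⟩ := key s
    rw [div_eq_zero_iff]
    left
    simp only [Pi.sub_apply, Pi.mul_apply]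
    field_simp
    linear_combination (Real.cos (ψ s)) * k2 - (Real.sin (ψ s)) * k1
  have e1 := is_const_of_deriv_eq_zero (fun s => (hc1 s).differentiableAt)
    (fun s => (hc1 s).deriv) s 0
  have e2 := is_const_of_deriv_eq_zero (fun s => (hc2 s).differentiableAt)
    (fun s => (hc2 s).deriv) s 0
  change x1 0 = - v 0 * _ at hx0
  change y1 0 = v 0 * _ at hy0
  have n0 := (hvpos 0).ne'
  have n1 := (hvpos s).ne'
  have t0 := Real.sin_sq_add_cos_sq (ψ 0)
  have t1 := Real.sin_sq_add_cos_sq (ψ s)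
  have f1 : x1 s * Real.cos (ψ s) + y1 s * Real.sin (ψ s) = 0 := by
    have : (x1 0 * Real.cos (ψ 0) + y1 0 * Real.sin (ψ 0)) / v 0 = 0 := by
      rw [hx0, hy0]; field_simp; ring
    rw [this, div_eq_zero_iff] at e1
    exact e1.resolve_right n1
  have f2 : y1 s * Real.cos (ψ s) - x1 s * Real.sin (ψ s) = v s := by
    have : (y1 0 * Real.cos (ψ 0) - x1 0 * Real.sin (ψ 0)) / v 0 = 1 := by
      rw [hx0, hy0, div_eq_one_iff_eq n0]; linear_combination v 0 * t0
    rw [this, div_eq_one_iff_eq n1] at e2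
    exact e2
  change x1 s = - v s * _ ∧ y1 s = v s * _
  constructor
  · linear_combination Real.cos (ψ s) * f1 - Real.sin (ψ s) * f2 - x1 s * t1
  · linear_combination Real.sin (ψ s) * f1 + Real.cos (ψ s) * f2 - y1 s * t1

/-- A continuous positive periodic function is bounded below by a positive constant. -/
lemma exists_pos_le_of_periodic {w : ℝ → ℝ} {L : ℝ} (hL : 0 < L) (hw : Continuous w)
    (hper : Function.Periodic w L) (hpos : ∀ s, 0 < w s) : ∃ c, 0 < c ∧ ∀ s, c ≤ w s := by
  obtain ⟨s0, -, hs0⟩ := isCompact_Icc.exists_isMinOn (nonempty_Icc.2 hL.le) hw.continuousOn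
  refine ⟨w s0, hpos s0, fun s => ?_⟩
  obtain ⟨t, ht, hst⟩ := hper.exists_mem_Ico₀ hL s
  rw [hst]
  exact hs0 (Ico_subset_Icc_self ht)

/-- A `C^∞` function whose derivative is bounded below by a positive constant is a homeomorphism
of the line. -/
lemma exists_homeomorph_of_deriv_ge {ψ κ : ℝ → ℝ} {c : ℝ} (hc : 0 < c)
    (hψ : ∀ s, HasDerivAt ψ (κ s) s) (hκ : ∀ s, c ≤ κ s) : ∃ e : ℝ ≃ₜ ℝ, ∀ s, e s = ψ s := by
  have hmono : StrictMono ψ := strictMono_of_deriv_pos fun s => by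
    rw [(hψ s).deriv]; exact hc.trans_le (hκ s)
  have hcont : Continuous ψ := continuous_iff_continuousAt.2 fun s => (hψ s).continuousAt
  have hmono' : Monotone fun s => ψ s - c * s := by
    have hd : ∀ s, HasDerivAt (fun s => ψ s - c * s) (κ s - c) s := fun s =>
      ((hψ s).sub ((hasDerivAt_id s).const_mul c)).congr_deriv (by simp)
    refine monotone_of_deriv_nonneg (fun s => (hd s).differentiableAt) fun s => ?_
    rw [(hd s).deriv]; linarith [hκ s]
  have htop : Filter.Tendsto ψ Filter.atTop Filter.atTop := by
    refine Filter.tendsto_atTop_mono' _ ?_ (Filter.tendsto_atTop_add_const_left _ (ψ 0)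
      (Filter.tendsto_id.const_mul_atTop hc))
    filter_upwards [Filter.eventually_ge_atTop 0] with s hs
    have := hmono' hs
    simp only [id, mul_zero, sub_zero] at this ⊢
    linarith
  have hbot : Filter.Tendsto ψ Filter.atBot Filter.atBot := by
    refine Filter.tendsto_atBot_mono' _ ?_ (Filter.tendsto_atBot_add_const_left _ (ψ 0)
      (Filter.tendsto_id.const_mul_atBot hc))
    filter_upwards [Filter.eventually_le_atBot 0] with s hs
    have := hmono' hs
    simp only [id, mul_zero, sub_zero] at this ⊢
    linarith
  exact ⟨(hmono.orderIsoOfSurjective ψ (hcont.surjective htop hbot)).toHomeomorph, fun s => rfl⟩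

/-- A closed curve of positive curvature can be parametrized by the angle of its outer normal. -/
lemma exists_normal_angle_param_of_pos {x y : ℝ → ℝ} {L : ℝ} (hL : 0 < L)
    (hx : ContDiff ℝ ∞ x) (hy : ContDiff ℝ ∞ y)
    (hxp : Function.Periodic x L) (hyp : Function.Periodic y L)
    (hreg : ∀ s, 0 < deriv x s ^ 2 + deriv y s ^ 2)
    (hpos : ∀ s, 0 < deriv x s * deriv (deriv y) s - deriv y s * deriv (deriv x) s) :
    ∃ X Y ρ : ℝ → ℝ, ContDiff ℝ ∞ ρ ∧ (∀ θ, 0 < ρ θ) ∧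
      (∀ θ, HasDerivAt X (-(ρ θ * Real.sin θ)) θ) ∧ (∀ θ, HasDerivAt Y (ρ θ * Real.cos θ) θ) ∧
      ∀ θ, ∃ s, X θ = x s ∧ Y θ = y s := by
  have hx1 : ContDiff ℝ ∞ (deriv x) := (contDiff_infty_iff_deriv.1 hx).2
  have hy1 : ContDiff ℝ ∞ (deriv y) := (contDiff_infty_iff_deriv.1 hy).2
  have hx2 : ContDiff ℝ ∞ (deriv (deriv x)) := (contDiff_infty_iff_deriv.1 hx1).2
  have hy2 : ContDiff ℝ ∞ (deriv (deriv y)) := (contDiff_infty_iff_deriv.1 hy1).2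
  have hper : ∀ {f : ℝ → ℝ}, Function.Periodic f L → Function.Periodic (deriv f) L := by
    intro f hf s
    have : (fun t => f (t + L)) = f := funext hf
    rw [← deriv_comp_add_const, this]
  -- The square of the speed, not its cube: this is the rate of turning in the parameter `s`, that
  -- is, curvature times speed.
  set κ : ℝ → ℝ := fun s => (deriv x s * deriv (deriv y) s - deriv y s * deriv (deriv x) s) /
    (deriv x s ^ 2 + deriv y s ^ 2) with hκ
  have hκs : ContDiff ℝ ∞ κ :=
    ((hx1.mul hy2).sub (hy1.mul hx2)).div ((hx1.pow 2).add (hy1.pow 2)) fun s => (hreg s).ne'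
  have hκpos : ∀ s, 0 < κ s := fun s => div_pos (hpos s) (hreg s)
  have hκper : Function.Periodic κ L := fun s => by
    simp only [hκ, hper hxp s, hper hyp s, hper (hper hxp) s, hper (hper hyp) s]
  obtain ⟨c, hc, hcκ⟩ := exists_pos_le_of_periodic hL hκs.continuous hκper hκpos
  -- The tangent at `0` rotated by `-π/2`, which is the outer normal of a positively oriented curve;
  -- its argument is the initial angle.
  set z : ℂ := ⟨deriv y 0, -deriv x 0⟩ with hz
  have hzn : ‖z‖ = √(deriv x 0 ^ 2 + deriv y 0 ^ 2) := by
    rw [Complex.norm_eq_sqrt_sq_add_sq, hz]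
    congr 1
    ring
  set ψ : ℝ → ℝ := fun s => z.arg + ∫ t in (0 : ℝ)..s, κ t with hψdef
  have hψ : ∀ s, HasDerivAt ψ (κ s) s := fun s =>
    (intervalIntegral.integral_hasDerivAt_right (hκs.continuous.intervalIntegrable _ _)
      (hκs.continuous.stronglyMeasurableAtFilter _ _) hκs.continuous.continuousAt).const_add _
  have hψs : ContDiff ℝ ∞ ψ := by
    refine contDiff_infty_iff_deriv.2 ⟨fun s => (hψ s).differentiableAt, ?_⟩
    rwa [show deriv ψ = κ from funext fun s => (hψ s).deriv]
  have hψ0 : ψ 0 = z.arg := by simp [hψdef]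
  obtain ⟨e, he⟩ := exists_homeomorph_of_deriv_ge hc hψ hcκ
  have heψ : (e : ℝ → ℝ) = ψ := funext he
  have hd : ∀ s, HasDerivAt e (κ s) s := fun s => by rw [heψ]; exact hψ s
  have hS : ContDiff ℝ ∞ e.symm := e.contDiff_symm_deriv (fun s => (hκpos s).ne') hd
    (by rw [heψ]; exact hψs)
  have hSd : ∀ θ, HasDerivAt e.symm (κ (e.symm θ))⁻¹ θ := fun θ =>
    HasDerivAt.of_local_left_inverse e.symm.continuous.continuousAt (hd _) (hκpos _).ne'
      (Filter.Eventually.of_forall fun t => e.apply_symm_apply t)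
  have hpolar := tangent_eq_polar (x1 := deriv x) (y1 := deriv y)
    (fun s => (hx1.differentiable (by simp) s).hasDerivAt)
    (fun s => (hy1.differentiable (by simp) s).hasDerivAt) hψ hreg
    (fun s => div_mul_cancel₀ _ (hreg s).ne')
    (by rw [hψ0, ← hzn]; have := Complex.norm_mul_sin_arg z; rw [neg_mul, this]; simp [hz])
    (by rw [hψ0, ← hzn]; have := Complex.norm_mul_cos_arg z; rw [this])
  have hψS : ∀ θ, ψ (e.symm θ) = θ := fun θ => by rw [← he, e.apply_symm_apply]
  refine ⟨x ∘ e.symm, y ∘ e.symm, fun θ => √(deriv x (e.symm θ) ^ 2 + deriv y (e.symm θ) ^ 2) /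
    κ (e.symm θ), ?_, ?_, ?_, ?_, fun θ => ⟨e.symm θ, rfl, rfl⟩⟩
  · refine ContDiff.div (ContDiff.sqrt ?_ fun θ => (hreg _).ne') (hκs.comp hS)
      fun θ => (hκpos _).ne'
    exact ((hx1.comp hS).pow 2).add ((hy1.comp hS).pow 2)
  · exact fun θ => div_pos (Real.sqrt_pos.2 (hreg _)) (hκpos _)
  · intro θ
    refine ((hx.differentiable (by simp) (e.symm θ)).hasDerivAt.comp θ (hSd θ)).congr_deriv ?_
    have := (hpolar (e.symm θ)).1
    rw [hψS] at this
    linear_combination (κ (e.symm θ))⁻¹ * this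
  · intro θ
    refine ((hy.differentiable (by simp) (e.symm θ)).hasDerivAt.comp θ (hSd θ)).congr_deriv ?_
    have := (hpolar (e.symm θ)).2
    rw [hψS] at this
    linear_combination (κ (e.symm θ))⁻¹ * this

/-- `(X, Y)` parametrizes a part of the boundary of `K` by the angle `θ` of its outer normal, and
`ρ` is the radius of curvature. -/
structure IsNormalAngleParam (K : Set Plane) (X Y ρ : ℝ → ℝ) : Prop where
  smooth : ContDiff ℝ ∞ ρ
  pos : ∀ θ, 0 < ρ θ
  hasDerivAt_fst : ∀ θ, HasDerivAt X (-(ρ θ * Real.sin θ)) θ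
  hasDerivAt_snd : ∀ θ, HasDerivAt Y (ρ θ * Real.cos θ) θ
  mem : ∀ θ, !₂[X θ, Y θ] ∈ frontier K

lemma HasDerivAt.plane_apply {γ : ℝ → Plane} {γ' : Plane} {s : ℝ} (h : HasDerivAt γ γ' s)
    (i : Fin 2) : HasDerivAt (fun s => γ s i) (γ' i) s :=
  (EuclideanSpace.proj (𝕜 := ℝ) i : Plane →L[ℝ] ℝ).hasFDerivAt.comp_hasDerivAt s h

/-- The numerator of the curvature is continuous and never zero, so it has one sign; if it is
negative, the curve is traversed backwards. -/
lemma exists_isNormalAngleParam {K : Set Plane} (hK : IsSmoothCurvedClosedCurve (frontier K)) :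
    ∃ X Y ρ : ℝ → ℝ, IsNormalAngleParam K X Y ρ := by
  obtain ⟨L, γ, hL, hγ, hper, -, hrange, hreg, hcurv⟩ := hK
  have hc : ∀ i, ContDiff ℝ ∞ fun s => γ s i := fun i => contDiff_euclidean.1 hγ i
  have hγ' : ContDiff ℝ ∞ (deriv γ) := (contDiff_infty_iff_deriv.1 hγ).2
  have hd : ∀ i, deriv (fun s => γ s i) = fun s => deriv γ s i := fun i => funext fun s =>
    ((hγ.differentiable (by simp) s).hasDerivAt.plane_apply i).deriv
  have hd2 : ∀ i, deriv (fun s => deriv γ s i) = fun s => deriv (deriv γ) s i :=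
    fun i => funext fun s => ((hγ'.differentiable (by simp) s).hasDerivAt.plane_apply i).deriv
  have hreg' : ∀ s, 0 < deriv γ s 0 ^ 2 + deriv γ s 1 ^ 2 := fun s => by
    have h := norm_pos_iff.2 (hreg s)
    have h2 := EuclideanSpace.real_norm_sq_eq (deriv γ s)
    rw [Fin.sum_univ_two] at h2
    rw [← h2]
    positivity
  set W : ℝ → ℝ := fun s =>
    deriv γ s 0 * deriv (deriv γ) s 1 - deriv γ s 1 * deriv (deriv γ) s 0 with hW
  have hW0 : ∀ s, W s ≠ 0 := fun s h => hcurv s (by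
    rw [curveCurvature, show _ - _ = W s from rfl, h, zero_div])
  have hWc : Continuous W := by
    have h1 := fun i => (contDiff_euclidean.1 hγ' i).continuous
    have h2 := fun i => (contDiff_euclidean.1 (contDiff_infty_iff_deriv.1 hγ').2 i).continuous
    exact ((h1 0).mul (h2 1)).sub ((h1 1).mul (h2 0))
  have hmem : ∀ s, !₂[γ s 0, γ s 1] ∈ frontier K := fun s => by
    rw [← hrange]
    refine ⟨s, ?_⟩
    ext i
    fin_cases i <;> rfl
  have hxp : ∀ i, Function.Periodic (fun s => γ s i) L := fun i s => by simp only [hper s]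
  rcases lt_or_ge 0 (W 0) with h0 | h0
  · have hpos : ∀ s, 0 < W s := by
      intro s
      by_contra! hs
      obtain ⟨t, ht⟩ := mem_range_of_exists_le_of_exists_ge hWc ⟨s, hs⟩ ⟨0, h0.le⟩
      exact hW0 t ht
    obtain ⟨X, Y, ρ, h1, h2, h3, h4, h5⟩ := exists_normal_angle_param_of_pos hL (hc 0) (hc 1)
      (hxp 0) (hxp 1) (fun s => by rw [hd, hd]; exact hreg' s)
      (fun s => by simp only [hd, hd2]; exact hpos s)
    refine ⟨X, Y, ρ, h1, h2, h3, h4, fun θ => ?_⟩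
    obtain ⟨s, hs1, hs2⟩ := h5 θ
    rw [hs1, hs2]
    exact hmem s
  · have hneg : ∀ s, W s < 0 := by
      intro s
      by_contra! hs
      obtain ⟨t, ht⟩ := mem_range_of_exists_le_of_exists_ge hWc ⟨0, h0⟩ ⟨s, hs⟩
      exact hW0 t ht
    have hr : ∀ i, deriv (fun s => γ (-s) i) = fun s => - deriv γ (-s) i := fun i => funext fun s => by
      rw [deriv_comp_neg (fun s => γ s i), hd]
    have hr2 : ∀ i, deriv (fun s => - deriv γ (-s) i) = fun s => deriv (deriv γ) (-s) i :=
      fun i => funext fun s => by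
        rw [deriv.fun_neg, deriv_comp_neg (fun s => deriv γ s i), hd2, neg_neg]
    have hrp : ∀ i, Function.Periodic (fun s => γ (-s) i) L := fun i s => by
      have := hxp i (-s - L)
      simp only [sub_add_cancel] at this
      simp only [neg_add', this]
    obtain ⟨X, Y, ρ, h1, h2, h3, h4, h5⟩ := exists_normal_angle_param_of_pos hL
      (x := fun s => γ (-s) 0) (y := fun s => γ (-s) 1)
      ((hc 0).comp contDiff_neg) ((hc 1).comp contDiff_neg)
      (hrp 0) (hrp 1) (fun s => by rw [hr, hr, neg_sq, neg_sq]; exact hreg' (-s))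
      (fun s => by
        simp only [hr, hr2]
        have := hneg (-s)
        simp only [hW] at this
        linarith)
    refine ⟨X, Y, ρ, h1, h2, h3, h4, fun θ => ?_⟩
    obtain ⟨s, hs1, hs2⟩ := h5 θ
    rw [hs1, hs2]
    exact hmem (-s)

/-! ### Support function of `K` and gauge of the dual set -/

namespace IsNormalAngleParam

variable {K : Set Plane} {X Y ρ : ℝ → ℝ}

/-- The tangent at `θ` is `ρ (-sin θ, cos θ)`, so the height in direction `α` changes at a rate
governed by `sin (θ - α)`: it falls for half a turn past `α` and is critical exactly at `α` modulo
`π`. -/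
lemma hasDerivAt_height (h : IsNormalAngleParam K X Y ρ) (α θ : ℝ) :
    HasDerivAt (fun θ => X θ * Real.cos α + Y θ * Real.sin α) (-(ρ θ * Real.sin (θ - α))) θ := by
  refine (((h.hasDerivAt_fst θ).mul_const _).add ((h.hasDerivAt_snd θ).mul_const _)).congr_deriv ?_
  rw [Real.sin_sub]
  ring

lemma continuous_param_fst (h : IsNormalAngleParam K X Y ρ) : Continuous X :=
  continuous_iff_continuousAt.2 fun θ => (h.hasDerivAt_fst θ).continuousAt

lemma continuous_param_snd (h : IsNormalAngleParam K X Y ρ) : Continuous Y :=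
  continuous_iff_continuousAt.2 fun θ => (h.hasDerivAt_snd θ).continuousAt

/-- The point with outer normal angle `θ` maximizes the corresponding linear functional. -/
lemma le_support (h : IsNormalAngleParam K X Y ρ) (hconv : Convex ℝ K)
    (h0 : (0 : Plane) ∈ interior K) (θ : ℝ) {x : Plane} (hx : x ∈ closure K) :
    x 0 * Real.cos θ + x 1 * Real.sin θ ≤ X θ * Real.cos θ + Y θ * Real.sin θ := by
  -- A supporting functional at the point of angle `θ` is maximal along the curve there, hence
  -- orthogonal to the tangent: it is `k (cos θ, sin θ)`. What remains is that `k > 0`.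
  obtain ⟨f, hf⟩ := geometric_hahn_banach_open_point hconv.interior isOpen_interior (h.mem θ).2
  set a := f (EuclideanSpace.single 0 1)
  set b := f (EuclideanSpace.single 1 1)
  have hfab : ∀ v : Plane, f v = v 0 * a + v 1 * b := fun v => by
    have : v = v 0 • EuclideanSpace.single 0 1 + v 1 • EuclideanSpace.single 1 1 := by
      ext i; fin_cases i <;> simp
    conv_lhs => rw [this]
    simp [a, b]
  have hle : ∀ v ∈ closure K, f v ≤ X θ * a + Y θ * b := by
    intro v hv
    rw [← hconv.closure_interior_eq_closure_of_nonempty_interior ⟨0, h0⟩] at hv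
    have : X θ * a + Y θ * b = f !₂[X θ, Y θ] := by rw [hfab]; simp
    rw [this]
    exact closure_minimal (fun w hw => (hf w hw).le)
      (isClosed_le f.continuous continuous_const) hv
  have hmax : ∀ t, X t * a + Y t * b ≤ X θ * a + Y θ * b := fun t => by
    have := hle _ (frontier_subset_closure (h.mem t))
    rw [hfab] at this
    simpa using this
  have hcrit : -(ρ θ * Real.sin θ) * a + ρ θ * Real.cos θ * b = 0 :=
    IsLocalMax.hasDerivAt_eq_zero (f := fun t => X t * a + Y t * b)
      (Filter.Eventually.of_forall hmax)
      (((h.hasDerivAt_fst θ).mul_const a).add ((h.hasDerivAt_snd θ).mul_const b))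
  have hcrit' : b * Real.cos θ = a * Real.sin θ := by
    have := (h.pos θ).ne'
    apply mul_left_cancel₀ this
    linarith
  set k := a * Real.cos θ + b * Real.sin θ with hk
  have hsc := Real.sin_sq_add_cos_sq θ
  have ha : a = k * Real.cos θ := by
    rw [hk]; linear_combination (-a) * hsc - Real.sin θ * hcrit'
  have hb : b = k * Real.sin θ := by
    rw [hk]; linear_combination (-b) * hsc + Real.cos θ * hcrit'
  have hkpos : 0 < k := by
    by_contra! hk0
    rcases hk0.lt_or_eq with hk0 | hk0
    -- For `k < 0`, the height in direction `θ` decreases up to `θ + π`, so the functional would be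
    -- larger there. For `k = 0` it would vanish and could not separate the interior point `0`.
    · have hanti : StrictAntiOn (fun t => X t * Real.cos θ + Y t * Real.sin θ)
          (Icc θ (θ + Real.pi)) := by
        refine strictAntiOn_of_deriv_neg (convex_Icc _ _)
          (fun t _ => (h.hasDerivAt_height θ t).continuousAt.continuousWithinAt) fun t ht => ?_
        rw [interior_Icc] at ht
        rw [(h.hasDerivAt_height θ t).deriv, neg_lt_zero]
        exact mul_pos (h.pos t) (Real.sin_pos_of_pos_of_lt_pi (by linarith [ht.1])
          (by linarith [ht.2]))
      have h1 := hanti (left_mem_Icc.2 (by linarith [Real.pi_pos]))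
        (right_mem_Icc.2 (by linarith [Real.pi_pos])) (by linarith [Real.pi_pos])
      have h2 := hmax (θ + Real.pi)
      rw [ha, hb] at h2
      simp only at h1
      nlinarith
    · have := hf 0 h0
      rw [hfab, hfab, ha, hb, hk0] at this
      simp at this
  have := hle x hx
  rw [hfab, ha, hb] at this
  have h2 : k * (x 0 * Real.cos θ + x 1 * Real.sin θ) ≤
      k * (X θ * Real.cos θ + Y θ * Real.sin θ) := by linarith
  exact le_of_mul_le_mul_left h2 hkpos

/-- The support function of `K` in terms of the normal angle. -/
lemma height_le (h : IsNormalAngleParam K X Y ρ) (hconv : Convex ℝ K)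
    (h0 : (0 : Plane) ∈ interior K) (θ t : ℝ) :
    X t * Real.cos θ + Y t * Real.sin θ ≤ X θ * Real.cos θ + Y θ * Real.sin θ := by
  simpa using h.le_support hconv h0 θ (frontier_subset_closure (h.mem t))

/-- Periodicity is not part of `IsNormalAngleParam`. The angles `θ` and `θ + 2π` define the same
functional, and the curve point at either angle maximizes it. -/
lemma periodic_support (h : IsNormalAngleParam K X Y ρ) (hconv : Convex ℝ K)
    (h0 : (0 : Plane) ∈ interior K) :
    Function.Periodic (fun θ => X θ * Real.cos θ + Y θ * Real.sin θ) (2 * Real.pi) := by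
  intro θ
  have h1 := h.height_le hconv h0 θ (θ + 2 * Real.pi)
  have h2 := h.height_le hconv h0 (θ + 2 * Real.pi) θ
  simp only [Real.cos_add_two_pi, Real.sin_add_two_pi] at h1 h2 ⊢
  exact le_antisymm h1 h2

/-- The support function and its derivative are the coordinates of the boundary point in the frame
at angle `θ`, so their periodicity passes to `X` and `Y`. -/
lemma periodic (h : IsNormalAngleParam K X Y ρ) (hconv : Convex ℝ K)
    (h0 : (0 : Plane) ∈ interior K) :
    Function.Periodic X (2 * Real.pi) ∧ Function.Periodic Y (2 * Real.pi) := by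
  have hp := h.periodic_support hconv h0
  have hd : ∀ θ, HasDerivAt (fun θ => X θ * Real.cos θ + Y θ * Real.sin θ)
      (-(X θ * Real.sin θ) + Y θ * Real.cos θ) θ := fun θ => by
    refine (((h.hasDerivAt_fst θ).mul (Real.hasDerivAt_cos θ)).add
      ((h.hasDerivAt_snd θ).mul (Real.hasDerivAt_sin θ))).congr_deriv ?_
    ring
  have hp' : ∀ θ, -(X (θ + 2 * Real.pi) * Real.sin θ) + Y (θ + 2 * Real.pi) * Real.cos θ =
      -(X θ * Real.sin θ) + Y θ * Real.cos θ := fun θ => by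
    have h1 := (hd (θ + 2 * Real.pi)).comp_add_const θ (2 * Real.pi)
    have h2 := (h1.congr_of_eventuallyEq (Filter.Eventually.of_forall fun t => (hp t).symm)).unique
      (hd θ)
    simpa only [Real.cos_add_two_pi, Real.sin_add_two_pi] using h2
  have hp0 : ∀ θ, X (θ + 2 * Real.pi) * Real.cos θ + Y (θ + 2 * Real.pi) * Real.sin θ =
      X θ * Real.cos θ + Y θ * Real.sin θ := fun θ => by
    simpa only [Real.cos_add_two_pi, Real.sin_add_two_pi] using hp θ
  constructor <;> intro θ <;> have hsc := Real.sin_sq_add_cos_sq θ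
  · linear_combination (X θ - X (θ + 2 * Real.pi)) * hsc + Real.cos θ * hp0 θ -
      Real.sin θ * hp' θ
  · linear_combination (Y θ - Y (θ + 2 * Real.pi)) * hsc + Real.sin θ * hp0 θ +
      Real.cos θ * hp' θ

lemma exists_support_ge (h : IsNormalAngleParam K X Y ρ) (hconv : Convex ℝ K)
    (h0 : (0 : Plane) ∈ interior K) :
    ∃ c, 0 < c ∧ ∀ θ, c ≤ X θ * Real.cos θ + Y θ * Real.sin θ := by
  obtain ⟨ε, hε, hball⟩ := Metric.isOpen_iff.1 isOpen_interior _ h0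
  refine ⟨ε / 2, by positivity, fun θ => ?_⟩
  have hsc := Real.sin_sq_add_cos_sq θ
  have hmem : (!₂[ε / 2 * Real.cos θ, ε / 2 * Real.sin θ] : Plane) ∈ Metric.ball 0 ε := by
    rw [mem_ball_zero_iff, ← sq_lt_sq₀ (norm_nonneg _) hε.le, EuclideanSpace.real_norm_sq_eq,
      Fin.sum_univ_two]
    simp only [Matrix.cons_val_zero, Matrix.cons_val_one]
    nlinarith
  have := h.le_support hconv h0 θ (subset_closure (interior_subset (hball hmem)))
  simp only [Matrix.cons_val_zero, Matrix.cons_val_one] at this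
  nlinarith

open scoped Pointwise in
/-- The gauge of the dual set is the support function of `K`. -/
lemma gauge_dualSet (h : IsNormalAngleParam K X Y ρ) (hconv : Convex ℝ K)
    (h0 : (0 : Plane) ∈ interior K) {m : ℝ} (hm : 0 ≤ m) (α : ℝ) :
    gauge (dualSet K) !₂[m * Real.cos α, m * Real.sin α] =
      m * (X α * Real.cos α + Y α * Real.sin α) := by
  rcases hm.eq_or_lt with rfl | hm
  · have : (!₂[0 * Real.cos α, 0 * Real.sin α] : Plane) = 0 := by
      ext i; fin_cases i <;> simp
    rw [this, gauge_zero, zero_mul]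
  obtain ⟨c, hc, hcp⟩ := h.exists_support_ge hconv h0
  set p := X α * Real.cos α + Y α * Real.sin α with hp
  have hpp : 0 < m * p := mul_pos hm (hc.trans_le (hcp α))
  have hiff : ∀ r, 0 < r → ((!₂[m * Real.cos α, m * Real.sin α] : Plane) ∈ r • dualSet K ↔
      m * p ≤ r) := by
    intro r hr
    rw [mem_smul_set_iff_inv_smul_mem₀ hr.ne']
    have hin : ∀ x : Plane, inner ℝ x (r⁻¹ • (!₂[m * Real.cos α, m * Real.sin α] : Plane)) =
        r⁻¹ * (m * (x 0 * Real.cos α + x 1 * Real.sin α)) := fun x => by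
      simp only [PiLp.inner_apply, Fin.sum_univ_two, PiLp.smul_apply, smul_eq_mul,
        Matrix.cons_val_zero, Matrix.cons_val_one, RCLike.inner_apply, conj_trivial]
      ring
    simp only [dualSet, mem_ofPred_eq, hin]
    have hr' : ∀ t : ℝ, r⁻¹ * t ≤ 1 ↔ t ≤ r := fun t => by
      rw [inv_mul_le_iff₀ hr, mul_one]
    simp only [hr']
    constructor
    · intro hle
      -- The maximizing point lies on the frontier and perhaps not in `K`, so the inequality is
      -- first extended to the closure.
      have hcl : closure K ⊆ {x | m * (x 0 * Real.cos α + x 1 * Real.sin α) ≤ r} :=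
        closure_minimal hle (isClosed_le (by fun_prop) continuous_const)
      simpa using hcl (frontier_subset_closure (h.mem α))
    · intro hle x hx
      exact (mul_le_mul_of_nonneg_left (h.le_support hconv h0 α (subset_closure hx)) hm.le).trans hle
  rw [gauge_def]
  have : {r | r ∈ Ioi 0 ∧ (!₂[m * Real.cos α, m * Real.sin α] : Plane) ∈ r • dualSet K} =
      Ici (m * p) := by
    ext r
    simp only [mem_ofPred_eq, mem_Ioi, mem_Ici]
    exact ⟨fun hr => (hiff r hr.1).1 hr.2, fun hr => ⟨hpp.trans_le hr, (hiff r (hpp.trans_le hr)).2 hr⟩⟩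
  rw [this, csInf_Ici]

end IsNormalAngleParam

/-! ### Comparison of normal angle and arc length -/

namespace IsNormalAngleParam

variable {K : Set Plane} {X Y ρ : ℝ → ℝ}

lemma continuous_param (h : IsNormalAngleParam K X Y ρ) :
    Continuous fun θ => (!₂[X θ, Y θ] : Plane) := by
  have h1 := h.continuous_param_fst
  have h2 := h.continuous_param_snd
  refine (PiLp.continuous_toLp 2 _).comp (continuous_pi fun i => ?_)
  fin_cases i
  · exact h1
  · exact h2

lemma exists_radius_bounds (h : IsNormalAngleParam K X Y ρ) (a b : ℝ) :
    ∃ c, 0 < c ∧ ∀ θ ∈ Icc a b, c ≤ ρ θ := by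
  rcases (Icc a b).eq_empty_or_nonempty with he | hne
  · exact ⟨1, one_pos, fun θ hθ => by simp [he] at hθ⟩
  obtain ⟨θ, -, hθ⟩ := isCompact_Icc.exists_isMinOn hne h.smooth.continuous.continuousOn
  exact ⟨ρ θ, h.pos θ, fun t ht => hθ ht⟩

/-- On intervals of length at most one the parametrization expands distances. -/
lemma mul_sub_le_dist (h : IsNormalAngleParam K X Y ρ) {a b c : ℝ}
    (hc : ∀ θ ∈ Icc a b, c ≤ ρ θ) (hc0 : 0 < c) {s t : ℝ} (hs : s ∈ Icc a b) (ht : t ∈ Icc a b)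
    (hst : s ≤ t) (hst1 : t ≤ s + 1) :
    c / 2 * (t - s) ≤ dist (!₂[X s, Y s] : Plane) !₂[X t, Y t] := by
  -- Displacement is measured along the tangent at `s`; its rate is `ρ cos (θ - s)`, and `cos ≥ 1 -
  -- 1/2` on an interval of length one.
  have hd : ∀ θ, HasDerivAt (fun θ => X θ * -Real.sin s + Y θ * Real.cos s)
      (ρ θ * Real.cos (θ - s)) θ := fun θ => by
    refine (((h.hasDerivAt_fst θ).mul_const _).add
      ((h.hasDerivAt_snd θ).mul_const _)).congr_deriv ?_
    rw [Real.cos_sub]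
    ring
  have hmvt := (convex_Icc s t).mul_sub_le_image_sub_of_le_deriv (C := c / 2)
    (f := fun θ => X θ * -Real.sin s + Y θ * Real.cos s)
    (fun θ _ => (hd θ).continuousAt.continuousWithinAt)
    (fun θ _ => (hd θ).differentiableAt.differentiableWithinAt) (fun θ hθ => by
      rw [interior_Icc] at hθ
      rw [(hd θ).deriv]
      have h1 := hc θ ⟨hs.1.trans hθ.1.le, hθ.2.le.trans ht.2⟩
      have h2 : 1 / 2 ≤ Real.cos (θ - s) := by
        have := Real.one_sub_sq_div_two_le_cos (x := θ - s)
        nlinarith [hθ.1, hθ.2]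
      nlinarith) s (left_mem_Icc.2 hst) t (right_mem_Icc.2 hst) hst
  refine hmvt.trans ?_
  rw [EuclideanSpace.dist_eq, Fin.sum_univ_two]
  simp only [Matrix.cons_val_zero, Matrix.cons_val_one, Real.dist_eq, sq_abs]
  apply Real.le_sqrt_of_sq_le
  nlinarith [Real.sin_sq_add_cos_sq s,
    sq_nonneg ((X s - X t) * Real.cos s + (Y s - Y t) * Real.sin s)]

/-- Integration in the normal angle is dominated by integration in arc length. -/
lemma exists_lintegral_le (h : IsNormalAngleParam K X Y ρ) :
    ∃ C : NNReal, ∀ G : Plane → ENNReal, Measurable G →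
      ∫⁻ θ in Icc (-Real.pi) Real.pi, G !₂[X θ, Y θ] ≤
        C * ∫⁻ w in frontier K, G w ∂(Measure.hausdorffMeasure 1) := by
  obtain ⟨c, hc, hcρ⟩ := h.exists_radius_bounds (-4) 4
  set γ : ℝ → Plane := fun θ => !₂[X θ, Y θ] with hγ
  have hγm : Measurable γ := h.continuous_param.measurable
  set k : NNReal := ⟨2 / c, by positivity⟩ with hk
  -- On a unit interval `γ` has a Lipschitz inverse, which controls Lebesgue measure by Hausdorff
  -- measure of the image. Eight such intervals cover `[-4, 4] ⊇ [-π, π]`.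
  have hloc : ∀ (i : ℕ), i < 8 → ∀ S : Set Plane,
      volume (Icc (-4 + i : ℝ) (-3 + i) ∩ γ ⁻¹' S) ≤
        k * Measure.hausdorffMeasure 1 (S ∩ frontier K) := by
    intro i hi S
    set A := Icc (-4 + i : ℝ) (-3 + i) ∩ γ ⁻¹' S with hA
    have hi' : (i : ℝ) + 1 ≤ 8 := by exact_mod_cast hi
    have hi0 : (0 : ℝ) ≤ i := i.cast_nonneg
    have hdist : ∀ s ∈ A, ∀ t ∈ A, dist s t ≤ k * dist (γ s) (γ t) := by
      have key : ∀ s ∈ A, ∀ t ∈ A, s ≤ t → dist s t ≤ k * dist (γ s) (γ t) := by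
        intro s hs t ht hst
        have := h.mul_sub_le_dist hcρ hc (s := s) (t := t)
          ⟨by linarith [hs.1.1], by linarith [hs.1.2]⟩ ⟨by linarith [ht.1.1], by linarith [ht.1.2]⟩
          hst (by linarith [hs.1.1, ht.1.2])
        rw [dist_comm, Real.dist_eq, abs_of_nonneg (sub_nonneg.2 hst)]
        change _ ≤ 2 / c * _
        rw [div_mul_eq_mul_div, le_div_iff₀ hc]
        simp only [hγ]
        linarith
      intro s hs t ht
      rcases le_total s t with hst | hst
      · exact key s hs t ht hst
      · rw [dist_comm s, dist_comm (γ s)]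
        exact key t ht s hs hst
    have hinj : InjOn γ A := fun s hs t ht hst => by
      have := hdist s hs t ht
      rw [hst, dist_self, mul_zero] at this
      exact dist_le_zero.1 this
    have hlip : LipschitzOnWith k (Function.invFunOn γ A) (γ '' A) := by
      refine LipschitzOnWith.of_dist_le_mul ?_
      rintro _ ⟨s, hs, rfl⟩ _ ⟨t, ht, rfl⟩
      rw [hinj.leftInvOn_invFunOn hs, hinj.leftInvOn_invFunOn ht]
      exact hdist s hs t ht
    have himg : Function.invFunOn γ A '' (γ '' A) = A := hinj.leftInvOn_invFunOn.image_image
    have := hlip.hausdorffMeasure_image_le zero_le_one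
    rw [himg, hausdorffMeasure_real, ENNReal.rpow_one] at this
    refine this.trans ?_
    gcongr
    rintro _ ⟨s, hs, rfl⟩
    exact ⟨hs.2, h.mem s⟩
  refine ⟨8 * k, fun G hG => ?_⟩
  have hmeas : (volume.restrict (Icc (-Real.pi) Real.pi)).map γ ≤
      ((8 * k : NNReal) : ENNReal) • (Measure.hausdorffMeasure 1).restrict (frontier K) := by
    refine Measure.le_iff.2 fun S hS => ?_
    rw [Measure.map_apply hγm hS, Measure.restrict_apply (hγm hS), Measure.smul_apply,
      Measure.restrict_apply hS, smul_eq_mul]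
    have hsub : γ ⁻¹' S ∩ Icc (-Real.pi) Real.pi ⊆
        ⋃ i ∈ Finset.range 8, (Icc (-4 + i : ℝ) (-3 + i) ∩ γ ⁻¹' S) := by
      rintro θ ⟨hθS, hθ⟩
      have hpi := Real.pi_lt_four
      have h4 : 0 ≤ θ + 4 := by linarith [hθ.1]
      simp only [Finset.mem_range, mem_iUnion]
      have hfl := Nat.floor_le h4
      have hfl' := Nat.lt_floor_add_one (θ + 4)
      refine ⟨⌊θ + 4⌋₊, ?_, ⟨by linarith, by linarith⟩, hθS⟩
      exact (Nat.floor_lt h4).2 (by push_cast; linarith [hθ.2])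
    calc _ ≤ _ := measure_mono hsub
      _ ≤ ∑ i ∈ Finset.range 8, _ := measure_biUnion_finset_le _ _
      _ ≤ ∑ i ∈ Finset.range 8, k * Measure.hausdorffMeasure 1 (S ∩ frontier K) :=
          Finset.sum_le_sum fun i hi => hloc i (Finset.mem_range.1 hi) S
      _ = _ := by
          rw [Finset.sum_const, Finset.card_range, nsmul_eq_mul]
          push_cast
          ring
  calc _ = ∫⁻ w, G w ∂((volume.restrict (Icc (-Real.pi) Real.pi)).map γ) :=
        (lintegral_map hG hγm).symm
    _ ≤ _ := lintegral_mono' hmeas le_rfl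
    _ = _ := by rw [lintegral_smul_measure, smul_eq_mul]

end IsNormalAngleParam

/-! ### The half derivative and its Fourier symbol -/

/-- The convolution of `f + f'` with the kernel `u^{-1/2} e^{-u}` on the half-line, written with
`u = w²`. -/
noncomputable def halfDeriv (f : ℝ → ℝ) (s : ℝ) : ℝ :=
  ∫ w : ℝ, (f (s - w ^ 2) + deriv f (s - w ^ 2)) * Real.exp (-w ^ 2)

lemma deriv_eq_zero_of_tsupport_subset {f : ℝ → ℝ} {S : Set ℝ} (hf : tsupport f ⊆ S) {r : ℝ}
    (hr : r ∉ S) : deriv f r = 0 := by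
  by_contra h
  exact hr (hf (support_deriv_subset h))

lemma eq_zero_of_tsupport_subset {f : ℝ → ℝ} {S : Set ℝ} (hf : tsupport f ⊆ S) {r : ℝ}
    (hr : r ∉ S) : f r = 0 := by
  by_contra h
  exact hr (hf (subset_tsupport f h))

/-- Causality: only values at `s - w² ≤ s` enter. It is what removes the lower fold of the boundary
curve. -/
lemma halfDeriv_eq_zero {f : ℝ → ℝ} {r s : ℝ} (hf : tsupport f ⊆ Ioi r) (hs : s ≤ r) :
    halfDeriv f s = 0 := by
  have : ∀ w : ℝ, s - w ^ 2 ∉ Ioi r := fun w hw => by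
    have := mem_Ioi.1 hw
    nlinarith [sq_nonneg w]
  simp [halfDeriv, eq_zero_of_tsupport_subset hf (this _),
    deriv_eq_zero_of_tsupport_subset hf (this _)]

/-- Fourier representation of `halfDeriv f`, with the size of its symbol. -/
lemma exists_fourier_halfDeriv {f : ℝ → ℝ} (hf : ContDiff ℝ ∞ f) (hc : HasCompactSupport f) :
    ∃ G F : ℝ → ℂ, Continuous F ∧ Integrable G ∧
      (∀ s, (halfDeriv f s : ℂ) =
        ∫ t : ℝ, G t * Complex.exp (((2 * Real.pi * t * s : ℝ) : ℂ) * Complex.I)) ∧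
      (∀ t, ‖G t‖ ^ 2 ≤ Real.pi * (1 + 2 * Real.pi * |t|) * ‖F t‖ ^ 2) ∧
      ∫⁻ t, ‖F t‖ₑ ^ 2 = ENNReal.ofReal (∫ r, f r ^ 2) := by
  set fc : ℝ → ℂ := fun r => (f r : ℂ) with hfc
  have hfcs : ContDiff ℝ ∞ fc := Complex.ofRealCLM.contDiff.comp hf
  have hfcc : HasCompactSupport fc := hc.comp_left Complex.ofReal_zero
  have hdc : deriv fc = fun r => ((deriv f r : ℝ) : ℂ) := funext fun r =>
    ((hf.differentiable (by simp) r).hasDerivAt.ofReal_comp).deriv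
  have hds : ContDiff ℝ ∞ (deriv fc) := (contDiff_infty_iff_deriv.1 hfcs).2
  set fS : 𝓢(ℝ, ℂ) := hfcc.toSchwartzMap hfcs with hfS
  set dS : 𝓢(ℝ, ℂ) := hfcc.deriv.toSchwartzMap hds with hdS
  have hfSc : (fS : ℝ → ℂ) = fc := rfl
  have hdSc : (dS : ℝ → ℂ) = deriv fc := rfl
  set J : 𝓢(ℝ, ℂ) := 𝓕 (fS + dS) with hJ
  have hJt : ∀ t, J t = (1 + 2 * Real.pi * Complex.I * t) * (𝓕 fS) t := by
    intro t
    have h1 : (𝓕 dS) t = (2 * Real.pi * Complex.I * t) • (𝓕 fS) t := by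
      have := Real.fourier_deriv (f := fc) (by rw [← hfSc]; exact fS.integrable)
        (hfcs.differentiable (by simp)) (by rw [← hdSc]; exact dS.integrable)
      rw [SchwartzMap.fourier_coe, SchwartzMap.fourier_coe, hdSc, hfSc, this]
    rw [hJ, FourierTransform.fourier_add, add_apply, h1, smul_eq_mul]
    ring
  have hinv : ∀ r : ℝ, ((f r + deriv f r : ℝ) : ℂ) =
      ∫ t : ℝ, J t * Complex.exp (((2 * Real.pi * t * r : ℝ) : ℂ) * Complex.I) := by
    intro r
    have h1 : 𝓕⁻ J = fS + dS := by rw [hJ]; exact FourierTransform.fourierInv_fourier_eq _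
    have h2 : (𝓕⁻ J) r = ((f r + deriv f r : ℝ) : ℂ) := by
      rw [h1, add_apply, hfSc, hdSc, hdc]
      push_cast
      rfl
    rw [← h2, SchwartzMap.fourierInv_coe, Real.fourierInv_eq']
    refine integral_congr_ae (Filter.Eventually.of_forall fun t => ?_)
    simp only [smul_eq_mul]
    rw [mul_comm]
    congr 3
    simp only [RCLike.inner_apply, conj_trivial]
    push_cast
    ring
  have hre : ∀ t : ℝ, (1 + 2 * Real.pi * Complex.I * t : ℂ).re = 1 := fun t => by simp
  have hnorm1 : ∀ t : ℝ, 1 ≤ ‖(1 + 2 * Real.pi * Complex.I * t : ℂ)‖ := fun t => by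
    have := Complex.re_le_norm (1 + 2 * Real.pi * Complex.I * t : ℂ)
    rwa [hre] at this
  -- By the complex Gaussian integral, `q` is the transform of the kernel `u^{-1/2} e^{-u}`.
  -- Multiplied by the factor `1 + 2πit` of `f + f'`, it leaves a symbol of squared modulus `π |1 +
  -- 2πit|`.
  set q : ℝ → ℂ := fun t => (Real.pi / (1 + 2 * Real.pi * Complex.I * t : ℂ)) ^ (1 / 2 : ℂ) with hq
  have hqn : ∀ t, ‖q t‖ ^ 2 = Real.pi / ‖(1 + 2 * Real.pi * Complex.I * t : ℂ)‖ := fun t => by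
    have : (1 / 2 : ℂ) = ((1 / 2 : ℝ) : ℂ) := by push_cast; rfl
    rw [hq]
    simp only [this]
    rw [Complex.norm_cpow_real, ← Real.sqrt_eq_rpow, Real.sq_sqrt (norm_nonneg _), norm_div,
      Complex.norm_real, Real.norm_of_nonneg Real.pi_pos.le]
  have hqg : ∀ t : ℝ, q t = ∫ w : ℝ, Complex.exp (-(1 + 2 * Real.pi * Complex.I * t) * w ^ 2) :=
    fun t => (integral_gaussian_complex (by rw [hre]; exact one_pos)).symm
  have hqm : Measurable q := by fun_prop
  have hexp : Integrable fun w : ℝ => Real.exp (-w ^ 2) := by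
    simpa using integrable_exp_neg_mul_sq one_pos
  refine ⟨fun t => J t * q t, fun t => (𝓕 fS) t, (𝓕 fS).continuous, ?_, ?_, ?_, ?_⟩
  · refine (J.integrable (μ := volume)).mul_bdd (c := √Real.pi) hqm.aestronglyMeasurable
      (Filter.Eventually.of_forall fun t => ?_)
    apply Real.le_sqrt_of_sq_le
    rw [hqn]
    exact div_le_self Real.pi_pos.le (hnorm1 t)
  · intro s
    have hint : Integrable (Function.uncurry fun (w t : ℝ) => (Real.exp (-w ^ 2) : ℂ) *
        (J t * Complex.exp (((2 * Real.pi * t * (s - w ^ 2) : ℝ) : ℂ) * Complex.I)))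
        (volume.prod volume) := by
      have h1 := (hexp.ofReal (𝕜 := ℂ)).mul_prod (J.integrable (μ := volume))
      have h2 : Continuous fun p : ℝ × ℝ =>
          Complex.exp (((2 * Real.pi * p.2 * (s - p.1 ^ 2) : ℝ) : ℂ) * Complex.I) := by fun_prop
      refine (h1.mul_bdd (c := 1) h2.aestronglyMeasurable
        (Filter.Eventually.of_forall fun p => by rw [Complex.norm_exp_ofReal_mul_I])).congr
        (Filter.Eventually.of_forall fun p => ?_)
      simp [Function.uncurry, mul_assoc]
    rw [halfDeriv, ← integral_complex_ofReal]
    calc ∫ w : ℝ, (((f (s - w ^ 2) + deriv f (s - w ^ 2)) * Real.exp (-w ^ 2) : ℝ) : ℂ)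
        = ∫ w : ℝ, ∫ t : ℝ, (Real.exp (-w ^ 2) : ℂ) *
        (J t * Complex.exp (((2 * Real.pi * t * (s - w ^ 2) : ℝ) : ℂ) * Complex.I)) := by
          refine integral_congr_ae (Filter.Eventually.of_forall fun w => ?_)
          simp only
          rw [integral_const_mul, ← hinv, mul_comm, Complex.ofReal_mul]
      _ = ∫ t : ℝ, ∫ w : ℝ, (Real.exp (-w ^ 2) : ℂ) *
        (J t * Complex.exp (((2 * Real.pi * t * (s - w ^ 2) : ℝ) : ℂ) * Complex.I)) :=
          integral_integral_swap hint
      _ = _ := by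
          refine integral_congr_ae (Filter.Eventually.of_forall fun t => ?_)
          simp only
          rw [hqg, ← integral_const_mul, ← integral_mul_const]
          refine integral_congr_ae (Filter.Eventually.of_forall fun w => ?_)
          simp only
          rw [mul_assoc (J t), ← Complex.exp_add, mul_left_comm, Complex.ofReal_exp,
            ← Complex.exp_add]
          congr 2
          push_cast
          ring
  · intro t
    rw [norm_mul, mul_pow, hqn, hJt, norm_mul, mul_pow]
    have h0 : 0 < ‖(1 + 2 * Real.pi * Complex.I * t : ℂ)‖ := one_pos.trans_le (hnorm1 t)
    have h1 : ‖(1 + 2 * Real.pi * Complex.I * t : ℂ)‖ ≤ 1 + 2 * Real.pi * |t| := by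
      refine (norm_add_le _ _).trans ?_
      simp [abs_of_pos Real.pi_pos]
    have h2 : ‖(1 + 2 * Real.pi * Complex.I * t : ℂ)‖ ^ 2 * ‖(𝓕 fS) t‖ ^ 2 *
        (Real.pi / ‖(1 + 2 * Real.pi * Complex.I * t : ℂ)‖) =
        Real.pi * ‖(1 + 2 * Real.pi * Complex.I * t : ℂ)‖ * ‖(𝓕 fS) t‖ ^ 2 := by
      field_simp
    rw [h2]
    gcongr
  · have hP := SchwartzMap.integral_norm_sq_fourier fS
    have hi : Integrable fun t => ‖(𝓕 fS) t‖ ^ 2 :=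
      ((𝓕 fS).memLp 2 volume).integrable_norm_pow (by norm_num)
    have h1 : ∀ r, ‖fS r‖ ^ 2 = f r ^ 2 := fun r => by
      rw [hfSc, hfc]; simp
    simp only [h1] at hP
    rw [← hP, ofReal_integral_eq_lintegral_ofReal hi
      (Filter.Eventually.of_forall fun t => by positivity)]
    refine lintegral_congr fun t => ?_
    rw [ENNReal.ofReal_pow (norm_nonneg _), ofReal_norm]

/-! ### Half integration along a quadratic fold -/

/-- `D` vanishes to second order at `0`, is increasing with `D' ≥ c u` on `[0, b]`, and its second
and third derivatives are bounded by `C` there. -/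
structure IsQuadraticBranch (D D1 D2 D3 : ℝ → ℝ) (b c C : ℝ) : Prop where
  b_pos : 0 < b
  c_pos : 0 < c
  hasDerivAt : ∀ u, HasDerivAt D (D1 u) u
  hasDerivAt1 : ∀ u, HasDerivAt D1 (D2 u) u
  hasDerivAt2 : ∀ u, HasDerivAt D2 (D3 u) u
  zero : D 0 = 0
  zero1 : D1 0 = 0
  le1 : ∀ u ∈ Icc 0 b, c * u ≤ D1 u
  abs2 : ∀ u ∈ Icc 0 b, |D2 u| ≤ C
  abs3 : ∀ u ∈ Icc 0 b, |D3 u| ≤ C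

namespace IsQuadraticBranch

variable {D D1 D2 D3 : ℝ → ℝ} {b c C : ℝ}

lemma continuous (h : IsQuadraticBranch D D1 D2 D3 b c C) : Continuous D :=
  continuous_iff_continuousAt.2 fun u => (h.hasDerivAt u).continuousAt

lemma continuous1 (h : IsQuadraticBranch D D1 D2 D3 b c C) : Continuous D1 :=
  continuous_iff_continuousAt.2 fun u => (h.hasDerivAt1 u).continuousAt

lemma deriv_le (h : IsQuadraticBranch D D1 D2 D3 b c C) {u : ℝ} (hu : u ∈ Icc 0 b) :
    D1 u ≤ C * u := by
  have := (convex_Icc 0 b).image_sub_le_mul_sub_of_deriv_le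
    (f := D1) h.continuous1.continuousOn
    (fun u _ => (h.hasDerivAt1 u).differentiableAt.differentiableWithinAt)
    (fun t ht => by
      rw [(h.hasDerivAt1 t).deriv]
      exact (le_abs_self _).trans (h.abs2 t (interior_subset ht)))
    0 (left_mem_Icc.2 h.b_pos.le) u hu hu.1
  simpa [h.zero1] using this

lemma C_pos (h : IsQuadraticBranch D D1 D2 D3 b c C) : 0 < C := by
  have h1 := h.le1 b (right_mem_Icc.2 h.b_pos.le)
  have h2 := h.deriv_le (right_mem_Icc.2 h.b_pos.le)
  have h3 := mul_pos h.c_pos h.b_pos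
  exact pos_of_mul_pos_left (h3.trans_le (h1.trans h2)) h.b_pos.le

lemma le_sq (h : IsQuadraticBranch D D1 D2 D3 b c C) {u : ℝ} (hu : u ∈ Icc 0 b) :
    D u ≤ C * u ^ 2 := by
  have := (convex_Icc 0 u).image_sub_le_mul_sub_of_deriv_le (C := C * u)
    (f := D) h.continuous.continuousOn
    (fun u _ => (h.hasDerivAt u).differentiableAt.differentiableWithinAt)
    (fun t ht => by
      rw [(h.hasDerivAt t).deriv]
      have ht' := interior_subset ht
      exact (h.deriv_le ⟨ht'.1, ht'.2.trans hu.2⟩).trans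
        (mul_le_mul_of_nonneg_left ht'.2 h.C_pos.le))
    0 (left_mem_Icc.2 hu.1) u (right_mem_Icc.2 hu.1) hu.1
  rw [h.zero] at this
  linarith

lemma sq_le (h : IsQuadraticBranch D D1 D2 D3 b c C) {u : ℝ} (hu : u ∈ Icc 0 b) :
    c / 2 * u ^ 2 ≤ D u := by
  have hd : ∀ t, HasDerivAt (fun t => D t - c / 2 * t ^ 2) (D1 t - c * t) t := fun t =>
    ((h.hasDerivAt t).sub ((hasDerivAt_pow 2 t).const_mul (c / 2))).congr_deriv (by
      push_cast; ring)
  have := monotoneOn_of_deriv_nonneg (convex_Icc 0 b)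
    (fun t _ => (hd t).continuousAt.continuousWithinAt)
    (fun t _ => (hd t).differentiableAt.differentiableWithinAt)
    (fun t ht => by
      rw [(hd t).deriv]
      linarith [h.le1 t (interior_subset ht)])
    (left_mem_Icc.2 h.b_pos.le) hu hu.1
  simp only [h.zero] at this
  linarith

lemma nonneg (h : IsQuadraticBranch D D1 D2 D3 b c C) {u : ℝ} (hu : u ∈ Icc 0 b) : 0 ≤ D u :=
  le_trans (by have := h.c_pos; positivity) (h.sq_le hu)

lemma pos (h : IsQuadraticBranch D D1 D2 D3 b c C) {u : ℝ} (hu : u ∈ Ioc 0 b) : 0 < D u :=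
  lt_of_lt_of_le (by have := h.c_pos; have := hu.1; positivity) (h.sq_le ⟨hu.1.le, hu.2⟩)

lemma deriv_pos (h : IsQuadraticBranch D D1 D2 D3 b c C) {u : ℝ} (hu : u ∈ Ioc 0 b) : 0 < D1 u :=
  (mul_pos h.c_pos hu.1).trans_le (h.le1 u ⟨hu.1.le, hu.2⟩)

lemma mono (h : IsQuadraticBranch D D1 D2 D3 b c C) {u : ℝ} (hu : u ∈ Icc 0 b) : D u ≤ D b := by
  refine monotoneOn_of_deriv_nonneg (convex_Icc 0 b) h.continuous.continuousOn
    (fun t _ => (h.hasDerivAt t).differentiableAt.differentiableWithinAt)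
    (fun t ht => ?_) hu (right_mem_Icc.2 h.b_pos.le) hu.2
  rw [interior_Icc] at ht
  rw [(h.hasDerivAt t).deriv]
  exact (h.deriv_pos ⟨ht.1, ht.2.le⟩).le

lemma sqrt_ge (h : IsQuadraticBranch D D1 D2 D3 b c C) {u : ℝ} (hu : u ∈ Icc 0 b) :
    √(c / 2) * u ≤ √(D u) := by
  calc √(c / 2) * u = √(c / 2 * u ^ 2) := by
        rw [Real.sqrt_mul (by have := h.c_pos; positivity), Real.sqrt_sq hu.1]
    _ ≤ _ := Real.sqrt_le_sqrt (h.sq_le hu)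

/-- Numerator and denominator are both comparable to `u`. This quotient is the boundary factor in
the integration by parts and produces the main term. -/
lemma ratio_ge (h : IsQuadraticBranch D D1 D2 D3 b c C) {u : ℝ} (hu : u ∈ Ioc 0 b) :
    √(c / 2) / C ≤ √(D u) / D1 u := by
  have hu' : u ∈ Icc 0 b := ⟨hu.1.le, hu.2⟩
  rw [div_le_div_iff₀ h.C_pos (h.deriv_pos hu)]
  have h1 := h.sqrt_ge hu'
  have h2 := h.deriv_le hu'
  have h3 := h.C_pos
  calc √(c / 2) * D1 u ≤ √(c / 2) * (C * u) := by gcongr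
    _ = (√(c / 2) * u) * C := by ring
    _ ≤ _ := by gcongr

lemma hasDerivAt_ratio (h : IsQuadraticBranch D D1 D2 D3 b c C) {u : ℝ} (hu : u ∈ Ioc 0 b) :
    HasDerivAt (fun u => √(D u) / D1 u)
      ((D1 u ^ 2 - 2 * D u * D2 u) / (2 * √(D u) * D1 u ^ 2)) u := by
  have hD := h.pos hu
  have hD1 := h.deriv_pos hu
  refine (((h.hasDerivAt u).sqrt hD.ne').div (h.hasDerivAt1 u) hD1.ne').congr_deriv ?_
  have hs := Real.sqrt_pos.2 hD
  have hs2 := Real.sq_sqrt hD.le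
  have : D1 u ^ 2 - 2 * D u * D2 u = D1 u ^ 2 - 2 * √(D u) ^ 2 * D2 u := by rw [hs2]
  rw [this]
  field_simp

/-- The quadratic terms cancel in `D1² - 2 D D2`: it vanishes at `0` and has derivative `-2 D D3 =
O(u²)`, so it is at least `-2 C² u³`, while the denominator is at least a multiple of `u³`. The
bound on the third derivative serves this cancellation. -/
lemma deriv_ratio_ge (h : IsQuadraticBranch D D1 D2 D3 b c C) {u : ℝ} (hu : u ∈ Ioc 0 b) :
    -(C ^ 2 / (√(c / 2) * c ^ 2)) ≤ (D1 u ^ 2 - 2 * D u * D2 u) / (2 * √(D u) * D1 u ^ 2) := by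
  have hu' : u ∈ Icc 0 b := ⟨hu.1.le, hu.2⟩
  have hc := h.c_pos
  have hC := h.C_pos
  have hd : ∀ t, HasDerivAt (fun t => D1 t ^ 2 - 2 * D t * D2 t) (-(2 * D t * D3 t)) t := fun t =>
    (((h.hasDerivAt1 t).pow 2).sub (((h.hasDerivAt t).const_mul 2).mul
      (h.hasDerivAt2 t))).congr_deriv (by push_cast; ring)
  have hQ := (convex_Icc 0 u).mul_sub_le_image_sub_of_le_deriv (C := -(2 * C ^ 2 * u ^ 2))
    (f := fun t => D1 t ^ 2 - 2 * D t * D2 t)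
    (fun t _ => (hd t).continuousAt.continuousWithinAt)
    (fun t _ => (hd t).differentiableAt.differentiableWithinAt)
    (fun t ht => by
      rw [(hd t).deriv, neg_le_neg_iff]
      have ht' := interior_subset ht
      have ht2 : t ∈ Icc 0 b := ⟨ht'.1, ht'.2.trans hu.2⟩
      have h1 := h.le_sq ht2
      have h2 := (le_abs_self _).trans (h.abs3 t ht2)
      have h3 := h.nonneg ht2
      have h4 : t ^ 2 ≤ u ^ 2 := pow_le_pow_left₀ ht'.1 ht'.2 2
      calc 2 * D t * D3 t ≤ 2 * D t * C := by gcongr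
        _ ≤ 2 * (C * u ^ 2) * C := by gcongr; exact h1.trans (by gcongr)
        _ = _ := by ring) 0 (left_mem_Icc.2 hu'.1) u (right_mem_Icc.2 hu'.1) hu'.1
  simp only [h.zero, h.zero1] at hQ
  have hden : √(c / 2) * u * (c * u) ^ 2 ≤ √(D u) * D1 u ^ 2 :=
    mul_le_mul (h.sqrt_ge hu') (pow_le_pow_left₀ (mul_nonneg hc.le hu'.1) (h.le1 u hu') 2)
      (by positivity) (by positivity)
  have hpos : 0 < √(D u) * D1 u ^ 2 :=
    mul_pos (Real.sqrt_pos.2 (h.pos hu)) (pow_pos (h.deriv_pos hu) 2)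
  rw [le_div_iff₀ (by linarith)]
  have hsc : 0 < √(c / 2) := Real.sqrt_pos.2 (by positivity)
  have hkey : C ^ 2 / (√(c / 2) * c ^ 2) * (√(c / 2) * u * (c * u) ^ 2) = C ^ 2 * u ^ 3 := by
    field_simp
  have := mul_le_mul_of_nonneg_left hden
    (show 0 ≤ C ^ 2 / (√(c / 2) * c ^ 2) by positivity)
  rw [hkey] at this
  nlinarith

/-- Integration by parts along a branch. -/
lemma mul_integral_ge (h : IsQuadraticBranch D D1 D2 D3 b c C) {g : ℝ → ℝ} (hg : ContDiff ℝ ∞ g)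
    (hg0 : ∀ r, 0 ≤ g r) {H k m : ℝ} (hm : 0 ≤ m) (hb : g (H - k * D b) = 0) :
    √(c / 2) / C * g H - C ^ 2 / (√(c / 2) * c ^ 2) * Real.exp (m * D b) *
        (∫ u in (0 : ℝ)..b, g (H - k * D u)) ≤
      k * ∫ u in (0 : ℝ)..b, √(D u) * deriv g (H - k * D u) * Real.exp (m * D u) := by
  set B := C ^ 2 / (√(c / 2) * c ^ 2) with hB
  set M := Real.exp (m * D b) with hM
  have hB0 : 0 ≤ B := by have := h.c_pos; positivity
  have hDc := h.continuous
  have hgc := hg.continuous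
  have hgc' : Continuous (deriv g) := (contDiff_infty_iff_deriv.1 hg).2.continuous
  set j : ℝ → ℝ := fun u => k * (√(D u) * deriv g (H - k * D u) * Real.exp (m * D u)) +
    B * M * g (H - k * D u) with hj
  have hjc : Continuous j := by fun_prop
  have hgd : ∀ u, HasDerivAt (fun u => g (H - k * D u)) (deriv g (H - k * D u) * -(k * D1 u)) u :=
    fun u => ((hg.differentiable (by simp) _).hasDerivAt.comp u
      (((h.hasDerivAt u).const_mul k).const_sub H))
  have hed : ∀ u, HasDerivAt (fun u => Real.exp (m * D u)) (Real.exp (m * D u) * (m * D1 u)) u :=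
    fun u => ((h.hasDerivAt u).const_mul m).exp
  -- The quotient `√D / D1` is `0/0` at the origin, so the argument runs on `[δ, b]`; the resulting
  -- inequality no longer contains the quotient and passes to `δ → 0`.
  have hδ : ∀ δ ∈ Ioo 0 b, √(c / 2) / C * g (H - k * D δ) ≤ ∫ u in δ..b, j u := by
    intro δ hδ
    have hIcc : ∀ u ∈ Icc δ b, u ∈ Ioc 0 b := fun u hu => ⟨hδ.1.trans_le hu.1, hu.2⟩
    -- Integration by parts as monotonicity: the terms with `deriv g` cancel in `P'`, and `B * M`
    -- absorbs the possibly negative derivative of the quotient. At `b` the boundary term vanishes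
    -- by `hb`.
    set P : ℝ → ℝ := fun u => (∫ t in δ..u, j t) +
      g (H - k * D u) * (√(D u) / D1 u * Real.exp (m * D u)) with hP
    have hPd : ∀ u ∈ Icc δ b, HasDerivAt P (g (H - k * D u) * (B * M + ((D1 u ^ 2 -
        2 * D u * D2 u) / (2 * √(D u) * D1 u ^ 2) + m * √(D u)) * Real.exp (m * D u))) u := by
      intro u hu
      have h1 := intervalIntegral.integral_hasDerivAt_right (hjc.intervalIntegrable δ u)
        (hjc.stronglyMeasurableAtFilter _ _) hjc.continuousAt
      refine (h1.add ((hgd u).mul ((h.hasDerivAt_ratio (hIcc u hu)).mul (hed u)))).congr_deriv ?_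
      have hD1 := h.deriv_pos (hIcc u hu)
      have hs := Real.sqrt_pos.2 (h.pos (hIcc u hu))
      simp only [hj, Pi.mul_apply]
      field_simp
      ring
    have hmono := monotoneOn_of_deriv_nonneg (convex_Icc δ b)
      (fun u hu => (hPd u hu).continuousAt.continuousWithinAt)
      (fun u hu => (hPd u (interior_subset hu)).differentiableAt.differentiableWithinAt)
      (fun u hu => by
        have hu1 := interior_subset hu
        have hu' := hIcc u hu1
        rw [(hPd u hu1).deriv]
        refine mul_nonneg (hg0 _) ?_
        have h1 := h.deriv_ratio_ge hu'
        have h2 : Real.exp (m * D u) ≤ M :=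
          Real.exp_le_exp.2 (mul_le_mul_of_nonneg_left (h.mono ⟨hu'.1.le, hu'.2⟩) hm)
        have h3 : 0 < Real.exp (m * D u) := Real.exp_pos _
        have h4 : 0 ≤ m * √(D u) := by positivity
        have h5 : -B * Real.exp (m * D u) ≤ ((D1 u ^ 2 -
          2 * D u * D2 u) / (2 * √(D u) * D1 u ^ 2) + m * √(D u)) * Real.exp (m * D u) :=
          mul_le_mul_of_nonneg_right (by linarith) h3.le
        have h6 := mul_le_mul_of_nonneg_left h2 hB0
        linarith)
      (left_mem_Icc.2 hδ.2.le) (right_mem_Icc.2 hδ.2.le) hδ.2.le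
    simp only [hP, intervalIntegral.integral_same, hb, zero_mul, add_zero, zero_add] at hmono
    refine le_trans ?_ hmono
    rw [mul_comm]
    refine mul_le_mul_of_nonneg_left ?_ (hg0 _)
    have h1 := h.ratio_ge (hIcc δ (left_mem_Icc.2 hδ.2.le))
    have h2 : 1 ≤ Real.exp (m * D δ) :=
      Real.one_le_exp (mul_nonneg hm (h.nonneg ⟨hδ.1.le, hδ.2.le⟩))
    exact h1.trans (le_mul_of_one_le_right (by have := h.deriv_pos (hIcc δ (left_mem_Icc.2 hδ.2.le));
                                               positivity) h2)
  have hlim : √(c / 2) / C * g (H - k * D 0) ≤ ∫ u in (0 : ℝ)..b, j u := by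
    have hc1 : Continuous fun δ => √(c / 2) / C * g (H - k * D δ) := by fun_prop
    have hc2 : Continuous fun δ => ∫ u in δ..b, j u := by
      have : (fun δ => ∫ u in δ..b, j u) = fun δ => -∫ u in b..δ, j u :=
        funext fun δ => intervalIntegral.integral_symm _ _
      rw [this]
      exact (intervalIntegral.continuous_primitive (fun _ _ => hjc.intervalIntegrable _ _) b).neg
    have hmem : Ioo 0 b ∈ nhdsWithin (0 : ℝ) (Ioi 0) := Ioo_mem_nhdsGT h.b_pos
    refine le_of_tendsto_of_tendsto (hc1.continuousAt.mono_left nhdsWithin_le_nhds)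
      (hc2.continuousAt.mono_left nhdsWithin_le_nhds) (b := nhdsWithin (0 : ℝ) (Ioi 0)) ?_
    filter_upwards [hmem] with δ hδ' using hδ δ hδ'
  rw [h.zero, mul_zero, sub_zero] at hlim
  have hsplit : ∫ u in (0 : ℝ)..b, j u =
      k * (∫ u in (0 : ℝ)..b, √(D u) * deriv g (H - k * D u) * Real.exp (m * D u)) +
      B * M * ∫ u in (0 : ℝ)..b, g (H - k * D u) := by
    rw [← intervalIntegral.integral_const_mul, ← intervalIntegral.integral_const_mul,
      ← intervalIntegral.integral_add]
    · exact Continuous.intervalIntegrable (by fun_prop) _ _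
    · exact Continuous.intervalIntegrable (by fun_prop) _ _
  linarith

/-- A function of small mass has small mass along a branch. -/
lemma integral_le_sqrt (h : IsQuadraticBranch D D1 D2 D3 b c C) {f : ℝ → ℝ} (hf : Continuous f)
    (hfi : Integrable f) (hf0 : ∀ r, 0 ≤ f r) (hf1 : ∀ r, f r ≤ 1) {ε : ℝ} (hε : 0 < ε)
    (hεb : √ε ≤ b) (hfε : ∫ r, f r ≤ ε) {H k : ℝ} (hk : 0 < k) :
    ∫ u in (0 : ℝ)..b, f (H - k * D u) ≤ √ε * (1 + 1 / (k * c)) := by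
  have hDc := h.continuous
  have hD1c := h.continuous1
  have hc := h.c_pos
  have hs : 0 < √ε := Real.sqrt_pos.2 hε
  have hfc : Continuous fun u => f (H - k * D u) := by fun_prop
  -- The cut at `√ε` balances two bounds: `f ≤ 1` on the short piece, and beyond it the substitution
  -- `r = H - k D u`, whose Jacobian is at least `k c √ε`, gives `ε / (k c √ε)`.
  rw [← intervalIntegral.integral_add_adjacent_intervals (hfc.intervalIntegrable 0 √ε)
    (hfc.intervalIntegrable √ε b)]
  have h1 : ∫ u in (0 : ℝ)..√ε, f (H - k * D u) ≤ √ε := by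
    calc _ ≤ ∫ u in (0 : ℝ)..√ε, (1 : ℝ) := intervalIntegral.integral_mono_on hs.le
          (hfc.intervalIntegrable _ _) (by simp) fun u _ => hf1 _
      _ = _ := by simp
  have h2 : ∫ u in √ε..b, f (H - k * D u) ≤ √ε * (1 / (k * c)) := by
    have hsub : ∫ u in √ε..b, f (H - k * D u) * -(k * D1 u) =
        ∫ r in (H - k * D √ε)..(H - k * D b), f r :=
      intervalIntegral.integral_comp_mul_deriv (f := fun u => H - k * D u)
        (fun u _ => ((h.hasDerivAt u).const_mul k).const_sub H)
        (by fun_prop) hf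
    have hle : ∫ r in (H - k * D b)..(H - k * D √ε), f r ≤ ε := by
      have hm : D √ε ≤ D b := h.mono ⟨hs.le, hεb⟩
      rw [intervalIntegral.integral_of_le
        (by have := mul_le_mul_of_nonneg_left hm hk.le; linarith)]
      exact (setIntegral_le_integral hfi (Filter.Eventually.of_forall hf0)).trans hfε
    have hge : k * c * √ε * ∫ u in √ε..b, f (H - k * D u) ≤
        ∫ u in √ε..b, f (H - k * D u) * (k * D1 u) := by
      rw [← intervalIntegral.integral_const_mul]
      refine intervalIntegral.integral_mono_on hεb
        (Continuous.intervalIntegrable (by fun_prop) _ _)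
        (Continuous.intervalIntegrable (by fun_prop) _ _) fun u hu => ?_
      rw [mul_comm]
      refine mul_le_mul_of_nonneg_left ?_ (hf0 _)
      have h3 := h.le1 u ⟨hs.le.trans hu.1, hu.2⟩
      have h4 : c * √ε ≤ c * u := mul_le_mul_of_nonneg_left hu.1 hc.le
      rw [mul_assoc]
      exact mul_le_mul_of_nonneg_left (h4.trans h3) hk.le
    simp only [mul_neg, intervalIntegral.integral_neg] at hsub
    rw [intervalIntegral.integral_symm] at hle
    have hfin : k * c * √ε * ∫ u in √ε..b, f (H - k * D u) ≤ ε := by linarith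
    have hss : √ε * √ε = ε := Real.mul_self_sqrt hε.le
    rw [mul_one_div, le_div_iff₀ (mul_pos hk hc)]
    refine le_of_mul_le_mul_right ?_ hs
    linarith
  linarith

end IsQuadraticBranch

/-- The integrand of `halfDeriv` in terms of `e^r f(r)`. -/
lemma deriv_exp_mul {f : ℝ → ℝ} (hf : ContDiff ℝ ∞ f) (r : ℝ) :
    deriv (fun r => Real.exp r * f r) r = Real.exp r * (f r + deriv f r) := by
  have := (Real.hasDerivAt_exp r).mul (hf.differentiable (by simp) r).hasDerivAt
  rw [show deriv (fun r => Real.exp r * f r) r = _ from this.deriv]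
  ring

lemma exists_abs_add_deriv_le {f : ℝ → ℝ} (hf : ContDiff ℝ ∞ f) (hc : HasCompactSupport f) :
    ∃ A, ∀ r, |f r + deriv f r| ≤ A := by
  obtain ⟨A, hA⟩ := (hf.continuous.add
    (contDiff_infty_iff_deriv.1 hf).2.continuous).bounded_above_of_compact_support
    (hc.add hc.deriv)
  exact ⟨A, hA⟩

namespace IsQuadraticBranch

variable {D D1 D2 D3 : ℝ → ℝ} {b c C : ℝ}

/-- The integrand of the integral of `halfDeriv f (H - m D)` in scale-free coordinates. -/
noncomputable def kernel (D f : ℝ → ℝ) (H m : ℝ) (u v : ℝ) : ℝ :=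
  √m * Real.exp (-H) * (√(D u) * deriv (fun r => Real.exp r * f r) (H - m * (1 + v ^ 2) * D u) *
    Real.exp (m * D u))

/-- The substitution `w = √(m D u) v` in `halfDeriv f (H - m D u)`. It makes the argument of `f`
depend on `u` only through `m (1 + v²) D u`, so for fixed `v` the `u`-integral is again taken along
a branch. -/
lemma kernel_eq {f : ℝ → ℝ} (hf : ContDiff ℝ ∞ f) {H m u v : ℝ} (hm : 0 ≤ m) (hD : 0 ≤ D u) :
    kernel D f H m u v = √(m * D u) * ((f (H - m * D u - (√(m * D u) * v) ^ 2) +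
      deriv f (H - m * D u - (√(m * D u) * v) ^ 2)) * Real.exp (-(√(m * D u) * v) ^ 2)) := by
  rw [kernel, deriv_exp_mul hf, mul_pow, Real.sq_sqrt (mul_nonneg hm hD), Real.sqrt_mul hm]
  have h1 : H - m * (1 + v ^ 2) * D u = H - m * D u - m * D u * v ^ 2 := by ring
  have h2 : Real.exp (-(m * D u * v ^ 2)) =
      Real.exp (-H) * Real.exp (H - m * D u - m * D u * v ^ 2) * Real.exp (m * D u) := by
    rw [← Real.exp_add, ← Real.exp_add]; congr 1; ring
  rw [h1, h2]
  ring

lemma integrable_halfDeriv_integrand {f : ℝ → ℝ} (hf : ContDiff ℝ ∞ f) (hc : HasCompactSupport f)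
    (s : ℝ) :
    Integrable fun w : ℝ => (f (s - w ^ 2) + deriv f (s - w ^ 2)) * Real.exp (-w ^ 2) := by
  obtain ⟨A, hA⟩ := exists_abs_add_deriv_le hf hc
  have hf1 := hf.continuous
  have hf2 := (contDiff_infty_iff_deriv.1 hf).2.continuous
  refine (by simpa using integrable_exp_neg_mul_sq one_pos :
    Integrable fun w : ℝ => Real.exp (-w ^ 2)).bdd_mul (c := A)
    (Continuous.aestronglyMeasurable (by fun_prop)) (Filter.Eventually.of_forall fun w => hA _)

lemma integral_kernel_fst {f : ℝ → ℝ} (hf : ContDiff ℝ ∞ f) {H m u : ℝ} (hm : 0 < m)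
    (hD : 0 < D u) : ∫ v, kernel D f H m u v = halfDeriv f (H - m * D u) := by
  simp only [kernel_eq hf hm.le hD.le]
  have hs : 0 < √(m * D u) := Real.sqrt_pos.2 (mul_pos hm hD)
  rw [integral_const_mul, Measure.integral_comp_mul_left
    (fun w => (f (H - m * D u - w ^ 2) + deriv f (H - m * D u - w ^ 2)) * Real.exp (-w ^ 2)),
    abs_of_pos (inv_pos.2 hs), smul_eq_mul, mul_inv_cancel_left₀ hs.ne']
  rfl

lemma continuous_kernel (h : IsQuadraticBranch D D1 D2 D3 b c C) {f : ℝ → ℝ}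
    (hf : ContDiff ℝ ∞ f) (H m : ℝ) : Continuous fun p : ℝ × ℝ => kernel D f H m p.1 p.2 := by
  have hDc := h.continuous
  have hg : ContDiff ℝ ∞ fun r => Real.exp r * f r := Real.contDiff_exp.mul hf
  have hg' := (contDiff_infty_iff_deriv.1 hg).2.continuous
  unfold kernel
  fun_prop

/-- Undoing the substitution bounds each inner integral of the norm by the same multiple of a
Gaussian integral, uniformly in `u`. -/
lemma integrable_kernel (h : IsQuadraticBranch D D1 D2 D3 b c C) {f : ℝ → ℝ}
    (hf : ContDiff ℝ ∞ f) (hc : HasCompactSupport f) {H m : ℝ} (hm : 0 < m) :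
    Integrable (Function.uncurry (kernel D f H m)) ((volume.restrict (Ioc 0 b)).prod volume) := by
  obtain ⟨A, hA⟩ := exists_abs_add_deriv_le hf hc
  have hcont := h.continuous_kernel hf H m
  have hexp : Integrable fun w : ℝ => Real.exp (-w ^ 2) := by
    simpa using integrable_exp_neg_mul_sq one_pos
  change Integrable (fun p : ℝ × ℝ => kernel D f H m p.1 p.2) _
  rw [integrable_prod_iff hcont.aestronglyMeasurable]
  have hsec : ∀ u ∈ Ioc 0 b, Integrable (kernel D f H m u) ∧
      ∫ v, ‖kernel D f H m u v‖ ≤ ∫ w, A * Real.exp (-w ^ 2) := by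
    intro u hu
    have hD := h.pos hu
    have hs : 0 < √(m * D u) := Real.sqrt_pos.2 (mul_pos hm hD)
    have hi := integrable_halfDeriv_integrand hf hc (H - m * D u)
    have he : kernel D f H m u = fun v => √(m * D u) *
      (fun w => (f (H - m * D u - w ^ 2) + deriv f (H - m * D u - w ^ 2)) * Real.exp (-w ^ 2))
        (√(m * D u) * v) := funext fun v => kernel_eq hf hm.le hD.le
    refine ⟨by rw [he]; exact (hi.comp_mul_left' hs.ne').const_mul _, ?_⟩
    rw [he]
    simp only [norm_mul (√(m * D u)), Real.norm_of_nonneg hs.le]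
    rw [integral_const_mul, Measure.integral_comp_mul_left (fun w => ‖(f (H - m * D u - w ^ 2) +
      deriv f (H - m * D u - w ^ 2)) * Real.exp (-w ^ 2)‖),
      abs_of_pos (inv_pos.2 hs), smul_eq_mul, mul_inv_cancel_left₀ hs.ne']
    refine integral_mono hi.norm (hexp.const_mul A) fun w => ?_
    simp only [norm_mul, Real.norm_eq_abs, abs_of_pos (Real.exp_pos _)]
    exact mul_le_mul_of_nonneg_right (hA _) (Real.exp_pos _).le
  constructor
  · exact (ae_restrict_iff' measurableSet_Ioc).2 (Filter.Eventually.of_forall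
      fun u hu => (hsec u hu).1)
  · have hmeas : AEStronglyMeasurable (fun u => ∫ v, ‖kernel D f H m u v‖)
        (volume.restrict (Ioc 0 b)) :=
      (hcont.norm.stronglyMeasurable.integral_prod_right').aestronglyMeasurable
    refine Integrable.mono' (g := fun _ => ∫ w, A * Real.exp (-w ^ 2))
      (integrable_const _) hmeas ?_
    refine (ae_restrict_iff' measurableSet_Ioc).2 (Filter.Eventually.of_forall fun u hu => ?_)
    rw [Real.norm_of_nonneg (integral_nonneg fun v => norm_nonneg _)]
    exact (hsec u hu).2

/-- The contribution of a branch to the integral of `halfDeriv f` along a curve. -/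
lemma integral_halfDeriv_ge (h : IsQuadraticBranch D D1 D2 D3 b c C) {f : ℝ → ℝ}
    (hf : ContDiff ℝ ∞ f) (hc : HasCompactSupport f) (hf0 : ∀ r, 0 ≤ f r) (hf1 : ∀ r, f r ≤ 1)
    (hsupp : tsupport f ⊆ Ioi 0) {ε : ℝ} (hε : 0 < ε) (hεb : √ε ≤ b) (hfε : ∫ r, f r ≤ ε)
    {H m : ℝ} (hm : 0 < m) (hH : H ≤ m * D b) :
    Real.pi / √m * (√(c / 2) / C * f H - C ^ 2 / (√(c / 2) * c ^ 2) * Real.exp (m * D b) *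
        (√ε * (1 + 1 / (m * c)))) ≤
      ∫ u in (0 : ℝ)..b, halfDeriv f (H - m * D u) := by
  set B := C ^ 2 / (√(c / 2) * c ^ 2) with hB
  set M := Real.exp (m * D b) with hM
  set a := √(c / 2) / C with ha
  have hc0 := h.c_pos
  have hC0 := h.C_pos
  have hB0 : 0 ≤ B := by positivity
  have hsm : 0 < √m := Real.sqrt_pos.2 hm
  have hprod := h.integrable_kernel hf hc (H := H) hm
  have hswap : ∫ u in (0 : ℝ)..b, halfDeriv f (H - m * D u) =
      ∫ v, ∫ u in Ioc 0 b, kernel D f H m u v := by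
    rw [intervalIntegral.integral_of_le h.b_pos.le, ← integral_integral_swap hprod]
    exact setIntegral_congr_fun measurableSet_Ioc fun u hu =>
      (integral_kernel_fst hf hm (h.pos hu)).symm
  rw [hswap]
  have hg : ContDiff ℝ ∞ fun r => Real.exp r * f r := Real.contDiff_exp.mul hf
  -- Integration by parts with `k = m (1 + v²)` and `g = e^r f`. Dividing by `k` gives the weight
  -- `(1 + v²)⁻¹`, whose integral is the `π` of the conclusion; the error is largest at `v = 0`.
  have hpt : ∀ v : ℝ, (1 + v ^ 2)⁻¹ * (1 / √m * (a * f H - B * M * (√ε * (1 + 1 / (m * c))))) ≤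
      ∫ u in Ioc 0 b, kernel D f H m u v := by
    intro v
    have hv : 1 ≤ 1 + v ^ 2 := by nlinarith [sq_nonneg v]
    have hv0 : 0 < 1 + v ^ 2 := by linarith
    have hk : 0 < m * (1 + v ^ 2) := by positivity
    have hmk : m ≤ m * (1 + v ^ 2) := le_mul_of_one_le_right hm.le hv
    have hDb : 0 ≤ D b := h.nonneg (right_mem_Icc.2 h.b_pos.le)
    have hb0 : f (H - m * (1 + v ^ 2) * D b) = 0 := eq_zero_of_tsupport_subset hsupp (by
      simp only [mem_Ioi, not_lt]
      have := mul_le_mul_of_nonneg_right hmk hDb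
      linarith)
    have h1 := h.mul_integral_ge hg (fun r => mul_nonneg (Real.exp_pos r).le (hf0 r)) (H := H)
      (k := m * (1 + v ^ 2)) hm.le (by rw [hb0, mul_zero])
    have h2 := h.integral_le_sqrt hf.continuous (hf.continuous.integrable_of_hasCompactSupport hc)
      hf0 hf1 hε hεb hfε (H := H) hk
    have h3 : Real.exp (-H) * ∫ u in (0 : ℝ)..b, Real.exp (H - m * (1 + v ^ 2) * D u) *
        f (H - m * (1 + v ^ 2) * D u) ≤ ∫ u in (0 : ℝ)..b, f (H - m * (1 + v ^ 2) * D u) := by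
      have hfc := hf.continuous
      have hDc := h.continuous
      rw [← intervalIntegral.integral_const_mul]
      refine intervalIntegral.integral_mono_on h.b_pos.le
        (Continuous.intervalIntegrable (by fun_prop) _ _)
        (Continuous.intervalIntegrable (by fun_prop) _ _) fun u hu => ?_
      rw [← mul_assoc, ← Real.exp_add]
      refine mul_le_of_le_one_left (hf0 _) (Real.exp_le_one_iff.2 ?_)
      have := mul_nonneg hk.le (h.nonneg hu)
      linarith
    have h4 : √ε * (1 + 1 / (m * (1 + v ^ 2) * c)) ≤ √ε * (1 + 1 / (m * c)) := by
      gcongr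
    have h5 : Real.exp (-H) * (Real.exp H * f H) = f H := by
      rw [← mul_assoc, ← Real.exp_add]; simp
    have h6 : ∫ u in Ioc 0 b, kernel D f H m u v = √m * Real.exp (-H) *
        ∫ u in (0 : ℝ)..b, √(D u) * deriv (fun r => Real.exp r * f r)
          (H - m * (1 + v ^ 2) * D u) * Real.exp (m * D u) := by
      rw [intervalIntegral.integral_of_le h.b_pos.le, ← integral_const_mul]
      rfl
    set I := ∫ u in (0 : ℝ)..b, √(D u) * deriv (fun r => Real.exp r * f r)
          (H - m * (1 + v ^ 2) * D u) * Real.exp (m * D u)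
    have hE := Real.exp_pos (-H)
    have hBM : 0 ≤ B * M := mul_nonneg hB0 (Real.exp_pos _).le
    have h7 : a * f H - B * M * (√ε * (1 + 1 / (m * c))) ≤
        m * (1 + v ^ 2) * (Real.exp (-H) * I) := by
      have e1 := mul_le_mul_of_nonneg_left h1 hE.le
      have e2 := mul_le_mul_of_nonneg_left (h3.trans (h2.trans h4)) hBM
      calc _ ≤ a * (Real.exp (-H) * (Real.exp H * f H)) - B * M * (Real.exp (-H) *
            ∫ u in (0 : ℝ)..b, Real.exp (H - m * (1 + v ^ 2) * D u) *
            f (H - m * (1 + v ^ 2) * D u)) := by rw [h5]; linarith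
        _ = Real.exp (-H) * (a * (Real.exp H * f H) - B * M *
            ∫ u in (0 : ℝ)..b, Real.exp (H - m * (1 + v ^ 2) * D u) *
            f (H - m * (1 + v ^ 2) * D u)) := by ring
        _ ≤ _ := e1
        _ = _ := by ring
    rw [h6]
    calc (1 + v ^ 2)⁻¹ * (1 / √m * (a * f H - B * M * (√ε * (1 + 1 / (m * c)))))
        ≤ (1 + v ^ 2)⁻¹ * (1 / √m * (m * (1 + v ^ 2) * (Real.exp (-H) * I))) := by gcongr
      _ = (m / √m) * Real.exp (-H) * I := by field_simp
      _ = _ := by rw [Real.div_sqrt]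
  calc _ = ∫ v : ℝ, (1 + v ^ 2)⁻¹ * (1 / √m * (a * f H - B * M * (√ε * (1 + 1 / (m * c))))) := by
        rw [integral_mul_const, integral_univ_inv_one_add_sq]
        ring
    _ ≤ _ := integral_mono (integrable_inv_one_add_sq.mul_const _) hprod.integral_prod_right hpt

end IsQuadraticBranch

/-! ### From a single fold to the whole boundary curve -/

lemma continuous_halfDeriv {f : ℝ → ℝ} (hf : ContDiff ℝ ∞ f) (hc : HasCompactSupport f) :
    Continuous (halfDeriv f) := by
  obtain ⟨A, hA⟩ := exists_abs_add_deriv_le hf hc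
  have hf1 := hf.continuous
  have hf2 := (contDiff_infty_iff_deriv.1 hf).2.continuous
  have hexp : Integrable fun w : ℝ => Real.exp (-w ^ 2) := by
    simpa using integrable_exp_neg_mul_sq one_pos
  refine continuous_of_dominated (bound := fun w => A * Real.exp (-w ^ 2))
    (fun s => (Continuous.aestronglyMeasurable (by fun_prop)))
    (fun s => Filter.Eventually.of_forall fun w => ?_) (hexp.const_mul A)
    (Filter.Eventually.of_forall fun w => by fun_prop)
  rw [norm_mul, Real.norm_eq_abs, Real.norm_of_nonneg (Real.exp_pos _).le]
  exact mul_le_mul_of_nonneg_right (hA _) (Real.exp_pos _).le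

lemma exists_polar (z : Plane) : ∃ α ∈ Icc (-Real.pi) Real.pi, z 0 = ‖z‖ * Real.cos α ∧
    z 1 = ‖z‖ * Real.sin α := by
  set w : ℂ := ⟨z 0, z 1⟩ with hw
  have hwn : ‖w‖ = ‖z‖ := by
    rw [Complex.norm_eq_sqrt_sq_add_sq, EuclideanSpace.norm_eq, Fin.sum_univ_two]
    simp [hw]
  refine ⟨w.arg, ⟨(Complex.neg_pi_lt_arg w).le, Complex.arg_le_pi w⟩, ?_, ?_⟩
  · rw [← hwn, Complex.norm_mul_cos_arg]
  · rw [← hwn, Complex.norm_mul_sin_arg]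

/-- Jordan's inequality, applied to `u` on the first quarter turn and to `π - u` on the second. -/
lemma mul_le_sin_of_le_pi_sub {δ u : ℝ} (hδ : 0 < δ) (hδ' : δ ≤ Real.pi / 2) (hu : 0 ≤ u)
    (hu' : u ≤ Real.pi - δ) : 2 * δ / Real.pi ^ 2 * u ≤ Real.sin u := by
  have hpi := Real.pi_pos
  rcases le_total u (Real.pi / 2) with h | h
  · refine le_trans ?_ (Real.mul_le_sin hu h)
    refine mul_le_mul_of_nonneg_right ?_ hu
    rw [div_le_div_iff₀ (by positivity) hpi]
    nlinarith
  · rw [← Real.sin_pi_sub]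
    refine le_trans ?_ (Real.mul_le_sin (x := Real.pi - u) (by linarith) (by linarith))
    have h1 : 2 / Real.pi * δ ≤ 2 / Real.pi * (Real.pi - u) := by gcongr; linarith
    refine le_trans ?_ h1
    have h2 : 2 * δ / Real.pi ^ 2 * u ≤ 2 * δ / Real.pi ^ 2 * Real.pi := by gcongr; linarith
    refine h2.trans (le_of_eq ?_)
    field_simp

namespace IsNormalAngleParam

variable {K : Set Plane} {X Y ρ : ℝ → ℝ}

/-- Distance of the point of normal angle `α + σ u` from the supporting line of normal angle `α`. -/
noncomputable def depth (X Y : ℝ → ℝ) (α σ u : ℝ) : ℝ :=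
  X α * Real.cos α + Y α * Real.sin α -
    (X (α + σ * u) * Real.cos α + Y (α + σ * u) * Real.sin α)

lemma hasDerivAt_depth (h : IsNormalAngleParam K X Y ρ) (α : ℝ) {σ : ℝ} (hσ : σ = 1 ∨ σ = -1)
    (u : ℝ) : HasDerivAt (depth X Y α σ) (ρ (α + σ * u) * Real.sin u) u := by
  have h1 : HasDerivAt (fun u => α + σ * u) σ u := by
    simpa using ((hasDerivAt_id u).const_mul σ).const_add α
  refine (((h.hasDerivAt_height α (α + σ * u)).comp u h1).const_sub
    (X α * Real.cos α + Y α * Real.sin α)).congr_deriv ?_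
  rcases hσ with rfl | rfl <;> simp

/-- Uniform quantitative form of the fold of a linear functional along the boundary curve. -/
lemma exists_isQuadraticBranch (h : IsNormalAngleParam K X Y ρ) (hconv : Convex ℝ K)
    (h0 : (0 : Plane) ∈ interior K) :
    ∃ b c C : ℝ, b ≤ Real.pi ∧ ∀ α ∈ Icc (-Real.pi) Real.pi, ∀ σ : ℝ, (σ = 1 ∨ σ = -1) →
      (∃ D1 D2 D3 : ℝ → ℝ, IsQuadraticBranch (depth X Y α σ) D1 D2 D3 b c C) ∧
      ∀ u ∈ Icc b Real.pi, X α * Real.cos α + Y α * Real.sin α ≤ depth X Y α σ u := by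
  have hpi := Real.pi_pos
  obtain ⟨p, hp, hpα⟩ := h.exists_support_ge hconv h0
  obtain ⟨c, hc, hcρ⟩ := h.exists_radius_bounds (-(2 * Real.pi)) (2 * Real.pi)
  have hs1 : ContDiff ℝ ∞ (deriv ρ) := (contDiff_infty_iff_deriv.1 h.smooth).2
  have hs2 : ContDiff ℝ ∞ (deriv (deriv ρ)) := (contDiff_infty_iff_deriv.1 hs1).2
  have hbound : ∀ g : ℝ → ℝ, Continuous g → ∃ A, ∀ θ ∈ Icc (-(2 * Real.pi)) (2 * Real.pi),
      |g θ| ≤ A := fun g hg => isCompact_Icc.exists_bound_of_continuousOn hg.continuousOn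
  obtain ⟨A0, hA0⟩ := hbound ρ h.smooth.continuous
  obtain ⟨A1, hA1⟩ := hbound _ hs1.continuous
  obtain ⟨A2, hA2⟩ := hbound _ hs2.continuous
  have hzero : (0 : ℝ) ∈ Icc (-(2 * Real.pi)) (2 * Real.pi) := ⟨by linarith, by linarith⟩
  have hA0p : 0 < A0 := (h.pos 0).trans_le ((le_abs_self _).trans (hA0 0 hzero))
  have hA1p : 0 ≤ A1 := (abs_nonneg _).trans (hA1 0 hzero)
  have hA2p : 0 ≤ A2 := (abs_nonneg _).trans (hA2 0 hzero)
  -- The branch stops at `π - δ`, before the lower fold at `π`. Since depth changes at rate at most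
  -- `A0` and `A0 δ ≤ p`, the height stays nonpositive on the discarded piece.
  set δ := min (p / A0) (Real.pi / 2) with hδ
  have hδ0 : 0 < δ := lt_min (by positivity) (by positivity)
  have hδ1 : δ ≤ Real.pi / 2 := min_le_right _ _
  have hδ2 : A0 * δ ≤ p := by
    have : δ ≤ p / A0 := min_le_left _ _
    rw [le_div_iff₀ hA0p] at this
    linarith
  refine ⟨Real.pi - δ, c * (2 * δ / Real.pi ^ 2), A0 + 2 * A1 + A2, by linarith, ?_⟩
  intro α hα σ hσ
  have hmem : ∀ u ∈ Icc 0 Real.pi, α + σ * u ∈ Icc (-(2 * Real.pi)) (2 * Real.pi) := by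
    intro u hu
    rcases hσ with rfl | rfl
    · exact ⟨by linarith [hα.1, hu.1], by linarith [hα.2, hu.2]⟩
    · exact ⟨by linarith [hα.1, hu.2], by linarith [hα.2, hu.1]⟩
  have hσ2 : σ * σ = 1 := by rcases hσ with rfl | rfl <;> norm_num
  have hσa : |σ| = 1 := by rcases hσ with rfl | rfl <;> simp
  have haff : ∀ u, HasDerivAt (fun u => α + σ * u) σ u := fun u => by
    simpa using ((hasDerivAt_id u).const_mul σ).const_add α
  have hρd : ∀ u, HasDerivAt (fun u => ρ (α + σ * u)) (deriv ρ (α + σ * u) * σ) u := fun u =>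
    (h.smooth.differentiable (by simp) _).hasDerivAt.comp u (haff u)
  have hρd2 : ∀ u, HasDerivAt (fun u => deriv ρ (α + σ * u)) (deriv (deriv ρ) (α + σ * u) * σ) u :=
    fun u => (hs1.differentiable (by simp) _).hasDerivAt.comp u (haff u)
  have hsin : ∀ u, |Real.sin u| ≤ 1 := Real.abs_sin_le_one
  have hcos : ∀ u, |Real.cos u| ≤ 1 := Real.abs_cos_le_one
  have hmul : ∀ {x y A : ℝ}, |x| ≤ A → |y| ≤ 1 → |x * y| ≤ A := fun {x y A} hx hy => by
    rw [abs_mul]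
    exact (mul_le_of_le_one_right (abs_nonneg _) hy).trans hx
  refine ⟨⟨fun u => ρ (α + σ * u) * Real.sin u,
    fun u => deriv ρ (α + σ * u) * σ * Real.sin u + ρ (α + σ * u) * Real.cos u,
    fun u => deriv (deriv ρ) (α + σ * u) * Real.sin u + (deriv ρ (α + σ * u) * σ * Real.cos u +
      deriv ρ (α + σ * u) * σ * Real.cos u) - ρ (α + σ * u) * Real.sin u, ?_⟩, ?_⟩
  · refine
      { b_pos := by linarith
        c_pos := by positivity
        hasDerivAt := h.hasDerivAt_depth α hσ
        hasDerivAt1 := fun u => (hρd u).mul (Real.hasDerivAt_sin u)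
        hasDerivAt2 := fun u => ?_
        zero := by simp [depth]
        zero1 := by simp
        le1 := fun u hu => ?_
        abs2 := fun u hu => ?_
        abs3 := fun u hu => ?_ }
    · refine ((((hρd2 u).mul_const σ).mul (Real.hasDerivAt_sin u)).add
        ((hρd u).mul (Real.hasDerivAt_cos u))).congr_deriv ?_
      linear_combination (deriv (deriv ρ) (α + σ * u) * Real.sin u) * hσ2
    · have h1 := hcρ _ (hmem u ⟨hu.1, by linarith [hu.2]⟩)
      have h2 := mul_le_sin_of_le_pi_sub hδ0 hδ1 hu.1 hu.2
      rw [mul_assoc]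
      exact mul_le_mul h1 h2 (mul_nonneg (by positivity) hu.1) (h.pos _).le
    · have hm := hmem u ⟨hu.1, by linarith [hu.2]⟩
      have h1 := hmul (hmul (hA1 _ hm) hσa.le) (hsin u)
      have h2 := hmul (hA0 _ hm) (hcos u)
      have h3 := abs_add_le (deriv ρ (α + σ * u) * σ * Real.sin u) (ρ (α + σ * u) * Real.cos u)
      linarith
    · have hm := hmem u ⟨hu.1, by linarith [hu.2]⟩
      have h1 := abs_le.1 (hmul (hmul (hA1 _ hm) hσa.le) (hcos u))
      have h2 := abs_le.1 (hmul (hA0 _ hm) (hsin u))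
      have h3 := abs_le.1 (hmul (hA2 _ hm) (hsin u))
      rw [abs_le]
      constructor <;> linarith
  · intro u hu
    -- At `u = π` the outer normal is opposite, so the depth is the full width of `K` in direction
    -- `α`, a sum of two support values.
    have hend : X α * Real.cos α + Y α * Real.sin α + p ≤ depth X Y α σ Real.pi := by
      have h1 := hpα (α + σ * Real.pi)
      have h2 : Real.cos (α + σ * Real.pi) = -Real.cos α ∧
          Real.sin (α + σ * Real.pi) = -Real.sin α := by
        rcases hσ with rfl | rfl
        · rw [one_mul]; exact ⟨Real.cos_add_pi _, Real.sin_add_pi _⟩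
        · rw [neg_one_mul, ← sub_eq_add_neg]; exact ⟨Real.cos_sub_pi _, Real.sin_sub_pi _⟩
      rw [h2.1, h2.2] at h1
      simp only [depth]
      linarith
    have hu0 : 0 ≤ u := by linarith [hu.1]
    have hmvt := (convex_Icc u Real.pi).image_sub_le_mul_sub_of_deriv_le (C := A0)
      (f := depth X Y α σ)
      (fun t _ => (h.hasDerivAt_depth α hσ t).continuousAt.continuousWithinAt)
      (fun t _ => (h.hasDerivAt_depth α hσ t).differentiableAt.differentiableWithinAt)
      (fun t ht => by
        have ht' := interior_subset ht
        rw [(h.hasDerivAt_depth α hσ t).deriv]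
        exact (le_abs_self _).trans (hmul (hA0 _ (hmem t ⟨hu0.trans ht'.1, ht'.2⟩)) (hsin t)))
      u (left_mem_Icc.2 hu.2) Real.pi (right_mem_Icc.2 hu.2) hu.2
    have : A0 * (Real.pi - u) ≤ A0 * δ := mul_le_mul_of_nonneg_left (by linarith [hu.1]) hA0p.le
    linarith

/-- The integral of `halfDeriv f` along the boundary curve dominates `f` of the dual norm. -/
lemma exists_integral_halfDeriv_ge (h : IsNormalAngleParam K X Y ρ) (hconv : Convex ℝ K)
    (h0 : (0 : Plane) ∈ interior K) {r R : ℝ} (hr : 0 < r) (hR : 0 < R) :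
    ∃ a B ε₀ : ℝ, 0 < a ∧ 0 ≤ B ∧ 0 < ε₀ ∧ ∀ f : ℝ → ℝ, ContDiff ℝ ∞ f → HasCompactSupport f →
      (∀ s, 0 ≤ f s) → (∀ s, f s ≤ 1) → tsupport f ⊆ Ioi r → ∀ ε, 0 < ε → ε ≤ ε₀ →
      ∫ s, f s ≤ ε → ∀ z : Plane, ‖z‖ ≤ R →
      a * f (gauge (dualSet K) z) - B * √ε ≤
        ∫ θ in (-Real.pi)..Real.pi, halfDeriv f (X θ * z 0 + Y θ * z 1) := by
  obtain ⟨b, c, C, hbpi, hbr⟩ := h.exists_isQuadraticBranch hconv h0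
  have hpi := Real.pi_pos
  have hb1 : ∃ D D1 D2 D3, IsQuadraticBranch D D1 D2 D3 b c C :=
    ⟨_, (hbr 0 ⟨by linarith, by linarith⟩ 1 (Or.inl rfl)).1⟩
  obtain ⟨D, D1, D2, D3, hQ0⟩ := hb1
  have hb0 := hQ0.b_pos
  have hc0 := hQ0.c_pos
  have hC0 := hQ0.C_pos
  have hpc : Continuous fun θ => X θ * Real.cos θ + Y θ * Real.sin θ :=
    (h.continuous_param_fst.mul Real.continuous_cos).add (h.continuous_param_snd.mul Real.continuous_sin)
  obtain ⟨P, hP⟩ := isCompact_Icc.exists_bound_of_continuousOn (s := Icc (-Real.pi) Real.pi)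
    hpc.continuousOn
  obtain ⟨p, hp, hpα⟩ := h.exists_support_ge hconv h0
  have hP0 : 0 < P := hp.trans_le ((hpα 0).trans ((le_abs_self _).trans
    (hP 0 ⟨by linarith, by linarith⟩)))
  set a0 := √(c / 2) / C with ha0
  set B0 := C ^ 2 / (√(c / 2) * c ^ 2) with hB0
  have ha0p : 0 < a0 := div_pos (Real.sqrt_pos.2 (by positivity)) hC0
  have hB0p : 0 ≤ B0 := by positivity
  -- If `‖z‖ < r / P`, the gauge of `z` is below `r` and nothing is to be shown; so `m0` is the
  -- least relevant length, and it makes the error constants uniform in `z`.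
  set m0 := r / P with hm0
  have hm0p : 0 < m0 := by positivity
  set B1 := Real.pi / √m0 * (B0 * Real.exp (R * (C * b ^ 2)) * (1 + 1 / (m0 * c))) with hB1
  have hB1p : 0 ≤ B1 := by positivity
  -- The factors `2` count the two branches leaving the maximum; `ε ≤ b ^ 2` places the cut `√ε`
  -- inside the branch.
  refine ⟨2 * (Real.pi / √R * a0), 2 * B1, b ^ 2, by positivity, by positivity, by positivity, ?_⟩
  intro f hf hfc hf0 hf1 hsupp ε hε hεb hfε z hz
  have hεb' : √ε ≤ b := Real.sqrt_le_iff.2 ⟨hb0.le, hεb⟩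
  set m := ‖z‖ with hm
  obtain ⟨α, hα, hz0, hz1⟩ := exists_polar z
  rw [← hm] at hz0 hz1
  have hm_nonneg : 0 ≤ m := norm_nonneg z
  set pα := X α * Real.cos α + Y α * Real.sin α with hpαd
  have hH : gauge (dualSet K) z = m * pα := by
    rw [← h.gauge_dualSet hconv h0 hm_nonneg α]
    congr 1
    ext i
    fin_cases i
    · exact hz0
    · exact hz1
  rw [hH]
  have hint : ∀ θ, X θ * z 0 + Y θ * z 1 = m * (X θ * Real.cos α + Y θ * Real.sin α) := fun θ => by
    rw [hz0, hz1]; ring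
  simp only [hint]
  rcases le_or_gt (m * pα) r with hle | hlt
  · have hΦ : ∀ θ, halfDeriv f (m * (X θ * Real.cos α + Y θ * Real.sin α)) = 0 := fun θ =>
      halfDeriv_eq_zero hsupp ((mul_le_mul_of_nonneg_left (h.height_le hconv h0 α θ)
        hm_nonneg).trans hle)
    have hf00 : f (m * pα) = 0 := eq_zero_of_tsupport_subset hsupp (by simpa using hle)
    simp only [hΦ, hf00, intervalIntegral.integral_zero]
    have := mul_nonneg hB1p (Real.sqrt_nonneg ε)
    linarith
  · have hmm0 : m0 ≤ m := by
      rw [hm0, div_le_iff₀ hP0]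
      exact hlt.le.trans (mul_le_mul_of_nonneg_left ((le_abs_self _).trans (hP α hα)) hm_nonneg)
    have hmp : 0 < m := hm0p.trans_le hmm0
    have hΦc := continuous_halfDeriv hf hfc
    have hXc := h.continuous_param_fst
    have hYc := h.continuous_param_snd
    have hbranch : ∀ σ : ℝ, (σ = 1 ∨ σ = -1) → Real.pi / √R * a0 * f (m * pα) - B1 * √ε ≤
        ∫ u in (0 : ℝ)..Real.pi,
          halfDeriv f (m * (X (α + σ * u) * Real.cos α + Y (α + σ * u) * Real.sin α)) := by
      intro σ hσ
      obtain ⟨⟨D1, D2, D3, hQ⟩, hfar⟩ := hbr α hα σ hσ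
      have heq : ∀ u, m * (X (α + σ * u) * Real.cos α + Y (α + σ * u) * Real.sin α) =
          m * pα - m * depth X Y α σ u := fun u => by simp only [depth]; ring
      simp only [heq]
      have hDc := hQ.continuous
      have hcc : Continuous fun u => halfDeriv f (m * pα - m * depth X Y α σ u) := by fun_prop
      rw [← intervalIntegral.integral_add_adjacent_intervals (hcc.intervalIntegrable 0 b)
        (hcc.intervalIntegrable b Real.pi)]
      have hz2 : ∫ u in b..Real.pi, halfDeriv f (m * pα - m * depth X Y α σ u) = 0 := by
        rw [intervalIntegral.integral_congr (g := fun _ => 0), intervalIntegral.integral_zero]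
        intro u hu
        rw [uIcc_of_le hbpi] at hu
        refine halfDeriv_eq_zero hsupp ?_
        have := mul_le_mul_of_nonneg_left (hfar u hu) hm_nonneg
        linarith
      rw [hz2, add_zero]
      have hfarb := hfar b (left_mem_Icc.2 hbpi)
      have hmain := hQ.integral_halfDeriv_ge hf hfc hf0 hf1
        (hsupp.trans (Ioi_subset_Ioi hr.le)) hε hεb' hfε (H := m * pα) hmp
        (mul_le_mul_of_nonneg_left hfarb hm_nonneg)
      refine le_trans ?_ hmain
      rw [mul_sub]
      refine sub_le_sub ?_ ?_
      · rw [mul_assoc]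
        have hff := hf0 (m * pα)
        gcongr
      · have hDb := hQ.le_sq (right_mem_Icc.2 hb0.le)
        have hDb0 := hQ.nonneg (right_mem_Icc.2 hb0.le)
        calc Real.pi / √m * (B0 * Real.exp (m * depth X Y α σ b) * (√ε * (1 + 1 / (m * c))))
            ≤ Real.pi / √m0 * (B0 * Real.exp (R * (C * b ^ 2)) * (√ε * (1 + 1 / (m0 * c)))) := by
              gcongr
          _ = _ := by rw [hB1]; ring
    -- Periodicity recentres the integral at the maximum `α`, whose two sides are the branches `σ =
    -- 1` and `σ = -1`.
    have hperX := h.periodic hconv h0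
    have hper : Function.Periodic (fun θ => halfDeriv f (m * (X θ * Real.cos α +
        Y θ * Real.sin α))) (2 * Real.pi) := fun θ => by
      simp only [hperX.1 θ, hperX.2 θ]
    have hshift : ∫ θ in (-Real.pi)..Real.pi, halfDeriv f (m * (X θ * Real.cos α +
        Y θ * Real.sin α)) = ∫ θ in (α - Real.pi)..(α + Real.pi), halfDeriv f (m *
        (X θ * Real.cos α + Y θ * Real.sin α)) := by
      have := hper.intervalIntegral_add_eq (-Real.pi) (α - Real.pi)
      rwa [show -Real.pi + 2 * Real.pi = Real.pi by ring,
        show α - Real.pi + 2 * Real.pi = α + Real.pi by ring] at this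
    have hcc : Continuous fun θ => halfDeriv f (m * (X θ * Real.cos α + Y θ * Real.sin α)) := by
      fun_prop
    rw [hshift, ← intervalIntegral.integral_add_adjacent_intervals
      (hcc.intervalIntegrable (α - Real.pi) α) (hcc.intervalIntegrable α (α + Real.pi))]
    have h1 := hbranch 1 (Or.inl rfl)
    have h2 := hbranch (-1) (Or.inr rfl)
    simp only [one_mul, neg_one_mul, ← sub_eq_add_neg] at h1 h2
    rw [intervalIntegral.integral_comp_add_left (fun θ => halfDeriv f (m * (X θ * Real.cos α +
        Y θ * Real.sin α))) α, add_zero] at h1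
    rw [intervalIntegral.integral_comp_sub_left (fun θ => halfDeriv f (m * (X θ * Real.cos α +
        Y θ * Real.sin α))) α, sub_zero] at h2
    linarith

end IsNormalAngleParam

/-! ### Fourier transform of the measure -/

section FourierMeasure

variable {μ : Measure Plane}

lemma continuous_fourierMeasure [IsFiniteMeasure μ] : Continuous (fourierMeasure μ) := by
  unfold fourierMeasure
  refine continuous_of_dominated (bound := fun _ => (1 : ℝ))
    (fun ξ => (Continuous.aestronglyMeasurable (by fun_prop)))
    (fun ξ => Filter.Eventually.of_forall fun x => ?_) (integrable_const _)
    (Filter.Eventually.of_forall fun x => by fun_prop)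
  rw [Complex.norm_exp_ofReal_mul_I]

lemma enorm_fourierMeasure_le (ξ : Plane) : ‖fourierMeasure μ ξ‖ₑ ≤ μ univ := by
  refine (enorm_integral_le_lintegral_enorm _).trans ?_
  have : ∀ x : Plane, ‖Complex.exp (((-(2 * Real.pi * inner ℝ x ξ) : ℝ) : ℂ) * Complex.I)‖ₑ = 1 :=
    fun x => by rw [← ofReal_norm, Complex.norm_exp_ofReal_mul_I, ENNReal.ofReal_one]
  simp only [this, lintegral_one, le_refl]

lemma integral_exp_inner_eq_conj (ξ : Plane) :
    ∫ x, Complex.exp (((2 * Real.pi * inner ℝ x ξ : ℝ) : ℂ) * Complex.I) ∂μ =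
      starRingEnd ℂ (fourierMeasure μ ξ) := by
  rw [fourierMeasure, ← integral_conj]
  refine integral_congr_ae (Filter.Eventually.of_forall fun x => ?_)
  simp only
  rw [← Complex.exp_conj, map_mul, Complex.conj_ofReal, Complex.conj_I]
  push_cast
  ring_nf

lemma fourierMeasure_neg (ξ : Plane) :
    fourierMeasure μ (-ξ) = starRingEnd ℂ (fourierMeasure μ ξ) := by
  rw [← integral_exp_inner_eq_conj, fourierMeasure]
  simp [inner_neg_right]

lemma enorm_fourierMeasure_neg (ξ : Plane) : ‖fourierMeasure μ (-ξ)‖ₑ = ‖fourierMeasure μ ξ‖ₑ := by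
  rw [fourierMeasure_neg, RCLike.enorm_conj]

/-- The energy identity for a character. -/
lemma integral_prod_exp_inner_sub [IsFiniteMeasure μ] (ξ : Plane) :
    ∫ p : Plane × Plane, Complex.exp (((2 * Real.pi * inner ℝ (p.1 - p.2) ξ : ℝ) : ℂ) * Complex.I)
      ∂(μ.prod μ) = ((‖fourierMeasure μ ξ‖ ^ 2 : ℝ) : ℂ) := by
  have h : ∀ p : Plane × Plane,
      Complex.exp (((2 * Real.pi * inner ℝ (p.1 - p.2) ξ : ℝ) : ℂ) * Complex.I) =
      Complex.exp (((2 * Real.pi * inner ℝ p.1 ξ : ℝ) : ℂ) * Complex.I) *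
        Complex.exp (((-(2 * Real.pi * inner ℝ p.2 ξ) : ℝ) : ℂ) * Complex.I) := fun p => by
    rw [← Complex.exp_add, inner_sub_left]
    congr 1
    push_cast
    ring
  simp only [h]
  rw [integral_prod_mul (fun x => Complex.exp (((2 * Real.pi * inner ℝ x ξ : ℝ) : ℂ) * Complex.I))
    (fun y => Complex.exp (((-(2 * Real.pi * inner ℝ y ξ) : ℝ) : ℂ) * Complex.I)),
    integral_exp_inner_eq_conj, ← fourierMeasure, Complex.conj_mul']
  push_cast
  rfl

end FourierMeasure

/-! ### The energy estimate -/

namespace IsNormalAngleParam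

variable {K : Set Plane} {X Y ρ : ℝ → ℝ}

/-- The spherical average of `|μ̂|²` in the normal angle parametrization. -/
noncomputable def average (X Y : ℝ → ℝ) (μ : Measure Plane) (t : ℝ) : ENNReal :=
  ∫⁻ θ in Ioc (-Real.pi) Real.pi, ‖fourierMeasure μ (t • !₂[X θ, Y θ])‖ₑ ^ 2

lemma measurable_average (h : IsNormalAngleParam K X Y ρ) (μ : Measure Plane) [IsFiniteMeasure μ] :
    Measurable (average X Y μ) := by
  unfold average
  have h1 := h.continuous_param
  have h2 := continuous_fourierMeasure (μ := μ)
  have : Measurable (Function.uncurry fun (t θ : ℝ) =>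
      ‖fourierMeasure μ (t • !₂[X θ, Y θ])‖ₑ ^ 2) := by
    refine Measurable.pow_const (Continuous.measurable ?_) 2
    exact (h2.comp (continuous_fst.smul (h1.comp continuous_snd))).enorm
  exact this.lintegral_prod_right'

lemma average_neg (μ : Measure Plane) (t : ℝ) : average X Y μ (-t) = average X Y μ t := by
  simp only [average, neg_smul, enorm_fourierMeasure_neg]

/-- For `t > 1` the normal angle average is bounded by the arc length average and the weight by a
multiple of `t`. On `[-1, 1]` the bound `|μ̂| ≤ μ(univ)` suffices, and negative `t` follow by
evenness. -/
lemma lintegral_average_lt_top (h : IsNormalAngleParam K X Y ρ) {μ : Measure Plane}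
    [IsFiniteMeasure μ] (hint : mattilaIntegral K μ < ⊤) :
    ∫⁻ t, ENNReal.ofReal (Real.pi * (1 + 2 * Real.pi * |t|)) * average X Y μ t ^ 2 < ⊤ := by
  obtain ⟨C, hC⟩ := h.exists_lintegral_le
  have hpi := Real.pi_pos
  set w : ℝ → ENNReal := fun t => ENNReal.ofReal (Real.pi * (1 + 2 * Real.pi * |t|)) *
    average X Y μ t ^ 2 with hw
  have hnear : ∫⁻ t in Icc (-1) 1, w t < ⊤ := by
    have hb : ∀ t ∈ Icc (-1 : ℝ) 1, w t ≤ ENNReal.ofReal (Real.pi * (1 + 2 * Real.pi)) *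
        (μ univ ^ 2 * ENNReal.ofReal (Real.pi - -Real.pi)) ^ 2 := by
      intro t ht
      have ht' := abs_le.2 ht
      have h1 : average X Y μ t ≤ μ univ ^ 2 * ENNReal.ofReal (Real.pi - -Real.pi) := by
        calc average X Y μ t ≤ ∫⁻ θ in Ioc (-Real.pi) Real.pi, μ univ ^ 2 :=
              lintegral_mono fun θ => pow_le_pow_left' (enorm_fourierMeasure_le _) 2
          _ = _ := by rw [setLIntegral_const, Real.volume_Ioc]
      have h2 : Real.pi * (1 + 2 * Real.pi * |t|) ≤ Real.pi * (1 + 2 * Real.pi) :=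
        mul_le_mul_of_nonneg_left (add_le_add_right
          (mul_le_of_le_one_right (by positivity) ht') 1) hpi.le
      exact mul_le_mul' (ENNReal.ofReal_le_ofReal h2) (pow_le_pow_left' h1 2)
    refine lt_of_le_of_lt (setLIntegral_mono_ae' measurableSet_Icc
      (Filter.Eventually.of_forall hb)) ?_
    rw [setLIntegral_const, Real.volume_Icc]
    exact ENNReal.mul_lt_top (ENNReal.mul_lt_top ENNReal.ofReal_lt_top (ENNReal.pow_lt_top
      (ENNReal.mul_lt_top (ENNReal.pow_lt_top (measure_lt_top _ _)) ENNReal.ofReal_lt_top)))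
      ENNReal.ofReal_lt_top
  have hfar : ∫⁻ t in Ioi 1, w t < ⊤ := by
    have hb : ∀ t ∈ Ioi (1 : ℝ), w t ≤ (ENNReal.ofReal (Real.pi * (1 + 2 * Real.pi)) * C ^ 2) *
        ((∫⁻ w in frontier K, ‖fourierMeasure μ (t • w)‖ₑ ^ 2 ∂(Measure.hausdorffMeasure 1)) ^ 2 *
          ENNReal.ofReal t) := by
      intro t ht
      have ht' : 1 < t := ht
      have h1 : average X Y μ t ≤
          C * ∫⁻ w in frontier K, ‖fourierMeasure μ (t • w)‖ₑ ^ 2 ∂(Measure.hausdorffMeasure 1) :=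
        (lintegral_mono_set Ioc_subset_Icc_self).trans (hC _
          (((continuous_fourierMeasure (μ := μ)).comp
            (continuous_const_smul t)).enorm.measurable.pow_const 2))
      have h2 : ENNReal.ofReal (Real.pi * (1 + 2 * Real.pi * |t|)) ≤
          ENNReal.ofReal (Real.pi * (1 + 2 * Real.pi)) * ENNReal.ofReal t := by
        rw [← ENNReal.ofReal_mul (by positivity), abs_of_pos (by linarith)]
        apply ENNReal.ofReal_le_ofReal
        nlinarith [mul_pos hpi (sub_pos.2 ht')]
      calc w t ≤ (ENNReal.ofReal (Real.pi * (1 + 2 * Real.pi)) * ENNReal.ofReal t) *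
            (C * ∫⁻ w in frontier K, ‖fourierMeasure μ (t • w)‖ₑ ^ 2
              ∂(Measure.hausdorffMeasure 1)) ^ 2 := by
            simp only [hw]
            gcongr
        _ = _ := by ring
    refine lt_of_le_of_lt (setLIntegral_mono_ae' measurableSet_Ioi
      (Filter.Eventually.of_forall hb)) ?_
    rw [lintegral_const_mul' _ _ (ENNReal.mul_ne_top ENNReal.ofReal_ne_top
      (ENNReal.pow_ne_top ENNReal.coe_ne_top))]
    exact ENNReal.mul_lt_top (ENNReal.mul_lt_top ENNReal.ofReal_lt_top
      (ENNReal.pow_lt_top ENNReal.coe_lt_top)) hint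
  have hfar' : ∫⁻ t in Iio (-1), w t < ⊤ := by
    have h1 : ∀ t, w (-t) = w t := fun t => by simp only [hw, abs_neg, average_neg]
    have h2 := (Measure.measurePreserving_neg (volume : Measure ℝ)).setLIntegral_comp_preimage_emb
      (MeasurableEquiv.neg ℝ).measurableEmbedding w (Ioi 1)
    have h3 : (Neg.neg ⁻¹' Ioi (1 : ℝ)) = Iio (-1) := by ext t; simp [lt_neg]
    rw [h3] at h2
    simp only [h1] at h2
    rwa [h2]
  have hcover : (univ : Set ℝ) ⊆ Icc (-1) 1 ∪ (Ioi 1 ∪ Iio (-1)) := by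
    intro t _
    rcases lt_or_ge t (-1) with h | h
    · exact Or.inr (Or.inr h)
    · rcases le_or_gt t 1 with h' | h'
      · exact Or.inl ⟨h, h'⟩
      · exact Or.inr (Or.inl h')
  calc ∫⁻ t, w t = ∫⁻ t in univ, w t := by rw [Measure.restrict_univ]
    _ ≤ ∫⁻ t in Icc (-1) 1 ∪ (Ioi 1 ∪ Iio (-1)), w t := lintegral_mono_set hcover
    _ ≤ (∫⁻ t in Icc (-1) 1, w t) + ∫⁻ t in Ioi 1 ∪ Iio (-1), w t := lintegral_union_le _ _ _
    _ ≤ (∫⁻ t in Icc (-1) 1, w t) + ((∫⁻ t in Ioi 1, w t) + ∫⁻ t in Iio (-1), w t) := by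
        gcongr; exact lintegral_union_le _ _ _
    _ < ⊤ := by simp [hnear, hfar, hfar']

/-- The energy estimate: the mutual energy of `μ` against the integral of `halfDeriv f` along the
boundary curve is bounded by the `L²` norm of `f`. -/
lemma exists_energy_le (h : IsNormalAngleParam K X Y ρ) {μ : Measure Plane}
    [IsFiniteMeasure μ] (hint : mattilaIntegral K μ < ⊤) :
    ∃ M : ℝ, 0 ≤ M ∧ ∀ f : ℝ → ℝ, ContDiff ℝ ∞ f → HasCompactSupport f →
      Integrable (fun p : Plane × Plane => ∫ θ in (-Real.pi)..Real.pi,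
        halfDeriv f (X θ * (p.1 - p.2) 0 + Y θ * (p.1 - p.2) 1)) (μ.prod μ) ∧
      ∫ p : Plane × Plane, (∫ θ in (-Real.pi)..Real.pi,
        halfDeriv f (X θ * (p.1 - p.2) 0 + Y θ * (p.1 - p.2) 1)) ∂(μ.prod μ) ≤
        M * √(∫ r, f r ^ 2) := by
  have hN := h.lintegral_average_lt_top hint
  set N := ∫⁻ t, ENNReal.ofReal (Real.pi * (1 + 2 * Real.pi * |t|)) * average X Y μ t ^ 2 with hNdef
  refine ⟨√N.toReal, Real.sqrt_nonneg _, fun f hf hc => ?_⟩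
  obtain ⟨G, F, hF, hG, hΦ, hGF, hPl⟩ := exists_fourier_halfDeriv hf hc
  set κ : Measure ℝ := volume.restrict (Ioc (-Real.pi) Real.pi) with hκ
  have hγ := h.continuous_param
  set E : Plane × Plane → ℝ × ℝ → ℂ := fun p q =>
    Complex.exp (((2 * Real.pi * inner ℝ (p.1 - p.2) (q.2 • !₂[X q.1, Y q.1] : Plane) : ℝ) : ℂ) *
      Complex.I) with hE
  have hEc : Continuous fun z : (Plane × Plane) × (ℝ × ℝ) => E z.1 z.2 := by
    have : Continuous fun z : (Plane × Plane) × (ℝ × ℝ) => (!₂[X z.2.1, Y z.2.1] : Plane) :=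
      hγ.comp (continuous_fst.comp continuous_snd)
    simp only [hE]
    fun_prop
  have hEn : ∀ p q, ‖E p q‖ = 1 := fun p q => Complex.norm_exp_ofReal_mul_I _
  have hG2 : Integrable (fun q : ℝ × ℝ => G q.2) (κ.prod volume) := by
    simpa using (integrable_const (μ := κ) (1 : ℂ)).mul_prod hG
  have hsec : ∀ p, Integrable (fun q : ℝ × ℝ => G q.2 * E p q) (κ.prod volume) := fun p =>
    hG2.mul_bdd (c := 1) (hEc.comp (Continuous.prodMk_right p)).aestronglyMeasurable
      (Filter.Eventually.of_forall fun q => (hEn p q).le)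
  have hall : Integrable (Function.uncurry fun (p : Plane × Plane) (q : ℝ × ℝ) => G q.2 * E p q)
      ((μ.prod μ).prod (κ.prod volume)) := by
    have h1 := (integrable_const (μ := μ.prod μ) (1 : ℂ)).mul_prod hG2
    simp only [one_mul] at h1
    exact h1.mul_bdd (c := 1) hEc.aestronglyMeasurable
      (Filter.Eventually.of_forall fun z => (hEn z.1 z.2).le)
  have hin : ∀ (p : Plane × Plane) (θ t : ℝ), 2 * Real.pi * inner ℝ (p.1 - p.2)
      (t • !₂[X θ, Y θ] : Plane) =
      2 * Real.pi * t * (X θ * (p.1 - p.2) 0 + Y θ * (p.1 - p.2) 1) := fun p θ t => by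
    simp only [PiLp.inner_apply, Fin.sum_univ_two, PiLp.smul_apply, smul_eq_mul,
      Matrix.cons_val_zero, Matrix.cons_val_one, RCLike.inner_apply, conj_trivial]
    ring
  have hFp : ∀ p : Plane × Plane, ((∫ θ in (-Real.pi)..Real.pi,
      halfDeriv f (X θ * (p.1 - p.2) 0 + Y θ * (p.1 - p.2) 1) : ℝ) : ℂ) =
      ∫ q, G q.2 * E p q ∂(κ.prod volume) := by
    intro p
    rw [integral_prod _ (hsec p), intervalIntegral.integral_of_le (by linarith [Real.pi_pos]),
      ← integral_complex_ofReal]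
    refine integral_congr_ae (Filter.Eventually.of_forall fun θ => ?_)
    simp only [hΦ, hE, hin]
  have hFint : Integrable (fun p : Plane × Plane => ∫ θ in (-Real.pi)..Real.pi,
        halfDeriv f (X θ * (p.1 - p.2) 0 + Y θ * (p.1 - p.2) 1)) (μ.prod μ) := by
    have h1 := hall.integral_prod_left
    simp only [Function.uncurry_apply_pair, ← hFp] at h1
    simpa using h1.re
  refine ⟨hFint, ?_⟩
  -- After Fubini, each character `e^{2πi (x - y) · ξ}` integrates to `|μ̂(ξ)|²` against `μ × μ`.
  have hid : ((∫ p : Plane × Plane, (∫ θ in (-Real.pi)..Real.pi,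
      halfDeriv f (X θ * (p.1 - p.2) 0 + Y θ * (p.1 - p.2) 1)) ∂(μ.prod μ) : ℝ) : ℂ) =
      ∫ q : ℝ × ℝ, G q.2 * ((‖fourierMeasure μ (q.2 • !₂[X q.1, Y q.1])‖ ^ 2 : ℝ) : ℂ)
        ∂(κ.prod volume) := by
    rw [← integral_complex_ofReal]
    simp only [hFp]
    rw [integral_integral_swap hall]
    refine integral_congr_ae (Filter.Eventually.of_forall fun q => ?_)
    simp only
    rw [integral_const_mul, integral_prod_exp_inner_sub]
  have hmeasμ : Continuous fun q : ℝ × ℝ => fourierMeasure μ (q.2 • !₂[X q.1, Y q.1]) :=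
    (continuous_fourierMeasure (μ := μ)).comp (continuous_snd.smul (hγ.comp continuous_fst))
  have hbound : ‖∫ p : Plane × Plane, (∫ θ in (-Real.pi)..Real.pi,
      halfDeriv f (X θ * (p.1 - p.2) 0 + Y θ * (p.1 - p.2) 1)) ∂(μ.prod μ)‖ₑ ≤
      ∫⁻ t, ‖G t‖ₑ * average X Y μ t := by
    have e1 : ∀ x : ℝ, ‖x‖ₑ = ‖(x : ℂ)‖ₑ := fun x => by
      rw [← ofReal_norm, ← ofReal_norm, Complex.norm_real]
    rw [e1, hid]
    refine (enorm_integral_le_lintegral_enorm _).trans (le_of_eq ?_)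
    have e2 : ∀ q : ℝ × ℝ,
        ‖G q.2 * ((‖fourierMeasure μ (q.2 • !₂[X q.1, Y q.1])‖ ^ 2 : ℝ) : ℂ)‖ₑ =
        ‖G q.2‖ₑ * ‖fourierMeasure μ (q.2 • !₂[X q.1, Y q.1])‖ₑ ^ 2 := fun q => by
      rw [enorm_mul, ← e1, enorm_pow, enorm_norm]
    simp only [e2]
    rw [lintegral_prod_symm _ (show AEMeasurable (fun q : ℝ × ℝ =>
      ‖G q.2‖ₑ * ‖fourierMeasure μ (q.2 • !₂[X q.1, Y q.1])‖ₑ ^ 2) (κ.prod volume) from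
      hG2.aestronglyMeasurable.enorm.mul (hmeasμ.enorm.measurable.pow_const 2).aemeasurable)]
    refine lintegral_congr fun t => ?_
    change ∫⁻ θ, ‖G t‖ₑ * ‖fourierMeasure μ (t • !₂[X θ, Y θ])‖ₑ ^ 2 ∂κ = _
    rw [lintegral_const_mul' _ _ enorm_ne_top, average]
  -- Cauchy–Schwarz with the half derivative weight moved onto the average: `F` then contributes
  -- `‖f‖₂` by Plancherel, and the weighted average contributes `N`.
  have hCS : ∫⁻ t, ‖G t‖ₑ * average X Y μ t ≤
      (∫⁻ t, ‖F t‖ₑ ^ 2) ^ (1 / 2 : ℝ) * N ^ (1 / 2 : ℝ) := by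
    set W : ℝ → ENNReal := fun t =>
      ENNReal.ofReal √(Real.pi * (1 + 2 * Real.pi * |t|)) * average X Y μ t with hW
    have hWm : Measurable W := by
      refine Measurable.mul ?_ (h.measurable_average μ)
      fun_prop
    have h1 : ∀ t, ‖G t‖ₑ * average X Y μ t ≤ ‖F t‖ₑ * W t := by
      intro t
      have h2 : ‖G t‖ₑ ≤ ‖F t‖ₑ * ENNReal.ofReal √(Real.pi * (1 + 2 * Real.pi * |t|)) := by
        rw [← ofReal_norm, ← ofReal_norm, ← ENNReal.ofReal_mul (norm_nonneg _)]
        apply ENNReal.ofReal_le_ofReal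
        have hp : 0 ≤ Real.pi * (1 + 2 * Real.pi * |t|) := by have := Real.pi_pos; positivity
        refine (sq_le_sq₀ (norm_nonneg _) (by positivity)).1 ?_
        rw [mul_pow, Real.sq_sqrt hp, mul_comm]
        exact hGF t
      simp only [hW]
      rw [← mul_assoc]
      gcongr
    have hH := ENNReal.lintegral_mul_le_Lp_mul_Lq volume Real.HolderConjugate.two_two
      hF.enorm.measurable.aemeasurable hWm.aemeasurable
    have hW2 : ∀ t, W t ^ (2 : ℝ) =
        ENNReal.ofReal (Real.pi * (1 + 2 * Real.pi * |t|)) * average X Y μ t ^ 2 := fun t => by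
      have hp : 0 ≤ Real.pi * (1 + 2 * Real.pi * |t|) := by have := Real.pi_pos; positivity
      rw [ENNReal.rpow_two, hW, mul_pow, ← ENNReal.ofReal_pow (Real.sqrt_nonneg _),
        Real.sq_sqrt hp]
    simp only [hW2, ENNReal.rpow_two] at hH
    exact (lintegral_mono h1).trans hH
  have hfin := hbound.trans hCS
  rw [hPl] at hfin
  have htop : ENNReal.ofReal (∫ r, f r ^ 2) ^ (1 / 2 : ℝ) * N ^ (1 / 2 : ℝ) ≠ ⊤ :=
    ENNReal.mul_ne_top (ENNReal.rpow_ne_top_of_nonneg (by norm_num) ENNReal.ofReal_ne_top)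
      (ENNReal.rpow_ne_top_of_nonneg (by norm_num) hN.ne)
  have hreal := ENNReal.toReal_mono htop hfin
  rw [toReal_enorm, ENNReal.toReal_mul, ← ENNReal.toReal_rpow, ← ENNReal.toReal_rpow,
    ENNReal.toReal_ofReal (integral_nonneg fun r => sq_nonneg _), ← Real.sqrt_eq_rpow,
    ← Real.sqrt_eq_rpow] at hreal
  rw [mul_comm]
  exact (le_abs_self _).trans hreal

end IsNormalAngleParam

/-! ### Distribution of distances -/

/-- A smooth bump function between a compact set and an open set of the line. -/
lemma exists_contDiff_bump {s U : Set ℝ} (hs : IsCompact s) (hU : IsOpen U) (hsU : s ⊆ U) :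
    ∃ f : ℝ → ℝ, ContDiff ℝ ∞ f ∧ HasCompactSupport f ∧ (∀ x, 0 ≤ f x) ∧ (∀ x, f x ≤ 1) ∧
      tsupport f ⊆ U ∧ ∀ x ∈ s, f x = 1 := by
  obtain ⟨L, hL, hsL, hLU⟩ := exists_compact_between hs hU hsU
  obtain ⟨f, hf, hrange, hsupp, hone⟩ := exists_contMDiff_support_eq_eq_one_iff
    (modelWithCornersSelf ℝ ℝ) (n := ⊤) isOpen_interior hs.isClosed hsL
  have htL : tsupport f ⊆ L := by
    rw [tsupport, hsupp]
    exact closure_minimal interior_subset hL.isClosed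
  exact ⟨f, contMDiff_iff_contDiff.1 hf, hL.of_isClosed_subset (isClosed_tsupport f) htL,
    fun x => (hrange (mem_range_self x)).1, fun x => (hrange (mem_range_self x)).2,
    htL.trans hLU, fun x hx => (hone x).1 hx⟩

lemma convex_dualSet (K : Set Plane) : Convex ℝ (dualSet K) := by
  intro ξ hξ η hη a b ha hb hab x hx
  rw [inner_add_right, inner_smul_right, inner_smul_right]
  have h1 := mul_le_mul_of_nonneg_left (hξ x hx) ha
  have h2 := mul_le_mul_of_nonneg_left (hη x hx) hb
  linarith

/-- Together with convexity of the dual set, this makes its gauge continuous. -/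
lemma dualSet_mem_nhds_zero {K : Set Plane} (hK : Bornology.IsBounded K) :
    dualSet K ∈ nhds (0 : Plane) := by
  obtain ⟨R, hR, hKR⟩ := hK.exists_pos_norm_le
  filter_upwards [Metric.ball_mem_nhds (0 : Plane) (inv_pos.2 hR)] with ξ hξ x hx
  rw [mem_ball_zero_iff] at hξ
  calc inner ℝ x ξ ≤ ‖x‖ * ‖ξ‖ := real_inner_le_norm x ξ
    _ ≤ R * R⁻¹ := mul_le_mul (hKR x hx) hξ.le (norm_nonneg _) hR.le
    _ = 1 := mul_inv_cancel₀ hR.ne'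

namespace IsNormalAngleParam

variable {K : Set Plane} {X Y ρ : ℝ → ℝ}

lemma gauge_dualSet_pos (h : IsNormalAngleParam K X Y ρ) (hconv : Convex ℝ K)
    (h0 : (0 : Plane) ∈ interior K) {z : Plane} (hz : z ≠ 0) : 0 < gauge (dualSet K) z := by
  obtain ⟨α, -, hz0, hz1⟩ := exists_polar z
  obtain ⟨c, hc, hcα⟩ := h.exists_support_ge hconv h0
  have : z = !₂[‖z‖ * Real.cos α, ‖z‖ * Real.sin α] := by
    ext i
    fin_cases i
    · exact hz0
    · exact hz1
  rw [this, h.gauge_dualSet hconv h0 (norm_nonneg z)]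
  exact mul_pos (norm_pos_iff.2 hz) (hc.trans_le (hcα α))

/-- The distribution of distances does not charge small open sets away from the origin. -/
lemma exists_measure_le_sqrt (h : IsNormalAngleParam K X Y ρ) (hconv : Convex ℝ K)
    (hbdd : Bornology.IsBounded K) (h0 : (0 : Plane) ∈ interior K)
    {μ : Measure Plane} [IsFiniteMeasure μ] (hint : mattilaIntegral K μ < ⊤) {R : ℝ} (hR : 0 < R)
    (hμR : ∀ᵐ p ∂(μ.prod μ), ‖p.1 - p.2‖ ≤ R) {r : ℝ} (hr : 0 < r) :
    ∃ A ε₀ : ℝ, 0 < ε₀ ∧ ∀ ε, 0 < ε → ε ≤ ε₀ → ∀ V : Set ℝ, IsOpen V → V ⊆ Ioi r →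
      volume V ≤ ENNReal.ofReal ε →
      (μ.prod μ).map (fun p => gauge (dualSet K) (p.1 - p.2)) V ≤ ENNReal.ofReal (A * √ε) := by
  obtain ⟨a, B, ε₀, ha, hB, hε₀, hF⟩ := h.exists_integral_halfDeriv_ge hconv h0 hr hR
  obtain ⟨M, hM, hE⟩ := h.exists_energy_le hint
  set T := (μ.prod μ).real univ with hT
  refine ⟨(M + B * T) / a, ε₀, hε₀, fun ε hε hεε V hV hVr hVε => ?_⟩
  have hgc : Continuous (gauge (dualSet K)) :=
    continuous_gauge (convex_dualSet K) (dualSet_mem_nhds_zero hbdd)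
  have hdc : Continuous fun p : Plane × Plane => gauge (dualSet K) (p.1 - p.2) := by fun_prop
  -- Inner regularity leaves a compact `s ⊆ V`. A bump equal to `1` on `s` and supported in `V` has
  -- both `∫ f` and `∫ f²` at most `ε`.
  rw [hV.measure_eq_iSup_isCompact]
  refine iSup₂_le fun s hsV => iSup_le fun hs => ?_
  obtain ⟨f, hf, hfc, hf0, hf1, hfV, hfs⟩ := exists_contDiff_bump hs hV hsV
  have hfi : Integrable f := hf.continuous.integrable_of_hasCompactSupport hfc
  have hfε : ∫ x, f x ≤ ε := by
    have hle : ENNReal.ofReal (∫ x, f x) ≤ ENNReal.ofReal ε := by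
      rw [ofReal_integral_eq_lintegral_ofReal hfi (Filter.Eventually.of_forall hf0)]
      refine le_trans ?_ hVε
      rw [← lintegral_indicator_one hV.measurableSet]
      refine lintegral_mono fun x => ?_
      by_cases hx : x ∈ V
      · simpa [hx] using hf1 x
      · simp [hx, eq_zero_of_tsupport_subset hfV hx]
    exact (ENNReal.ofReal_le_ofReal_iff hε.le).1 hle
  have hf2 : ∫ x, f x ^ 2 ≤ ε := by
    refine le_trans (integral_mono_of_nonneg (Filter.Eventually.of_forall fun x => sq_nonneg _) hfi
      (Filter.Eventually.of_forall fun x => ?_)) hfε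
    have := mul_le_of_le_one_right (hf0 x) (hf1 x)
    simpa only [sq] using this
  obtain ⟨hFi, hFle⟩ := hE f hf hfc
  have hfd : Integrable (fun p : Plane × Plane => f (gauge (dualSet K) (p.1 - p.2)))
      (μ.prod μ) :=
    Integrable.of_bound (hf.continuous.comp hdc).aestronglyMeasurable 1
      (Filter.Eventually.of_forall fun p => by
        rw [Real.norm_of_nonneg (hf0 _)]; exact hf1 _)
  have hmono : ∫ p : Plane × Plane, (a * f (gauge (dualSet K) (p.1 - p.2)) - B * √ε) ∂(μ.prod μ) ≤
      M * √ε := by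
    refine (integral_mono_ae ((hfd.const_mul a).sub (integrable_const _)) hFi ?_).trans
      (hFle.trans (mul_le_mul_of_nonneg_left (Real.sqrt_le_sqrt hf2) hM))
    filter_upwards [hμR] with p hp
    exact hF f hf hfc hf0 hf1 (hfV.trans hVr) ε hε hεε hfε _ hp
  rw [integral_sub (hfd.const_mul a) (integrable_const _), integral_const_mul, integral_const,
    ← hT, smul_eq_mul] at hmono
  have hfin : ∫ p : Plane × Plane, f (gauge (dualSet K) (p.1 - p.2)) ∂(μ.prod μ) ≤
      (M + B * T) / a * √ε := by
    rw [div_mul_eq_mul_div, le_div_iff₀ ha]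
    linarith
  refine le_trans ?_ (ENNReal.ofReal_le_ofReal hfin)
  rw [ofReal_integral_eq_lintegral_ofReal hfd (Filter.Eventually.of_forall fun p => hf0 _),
    Measure.map_apply hdc.measurable hs.measurableSet,
    ← lintegral_indicator_one (hdc.measurable hs.measurableSet)]
  refine lintegral_mono fun p => ?_
  by_cases hp : gauge (dualSet K) (p.1 - p.2) ∈ s
  · rw [hfs _ hp, indicator_of_mem (by exact hp)]
    simp
  · rw [indicator_of_notMem (by exact hp)]
    exact zero_le

/-- A point mass has infinite Mattila integral. -/
lemma mattilaIntegral_eq_top_of_ae_eq (h : IsNormalAngleParam K X Y ρ) {μ : Measure Plane}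
    [IsFiniteMeasure μ] (hμ : μ ≠ 0) {a : Plane} (ha : ∀ᵐ y ∂μ, a = y) :
    mattilaIntegral K μ = ⊤ := by
  by_contra hne
  have hlt := h.lintegral_average_lt_top (lt_top_iff_ne_top.2 hne)
  have hhat : ∀ ξ, ‖fourierMeasure μ ξ‖ₑ = μ univ := fun ξ => by
    have : fourierMeasure μ ξ = ∫ _, Complex.exp (((-(2 * Real.pi * inner ℝ a ξ) : ℝ) : ℂ) *
        Complex.I) ∂μ := by
      refine integral_congr_ae ?_
      filter_upwards [ha] with y hy
      rw [hy]
    rw [this, integral_const, ← ofReal_norm, norm_smul, Complex.norm_exp_ofReal_mul_I, mul_one,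
      Real.norm_of_nonneg measureReal_nonneg, ofReal_measureReal]
  have hpi := Real.pi_pos
  set c := ENNReal.ofReal Real.pi *
    (μ univ ^ 2 * ENNReal.ofReal (Real.pi - -Real.pi)) ^ 2 with hc
  have hc0 : c ≠ 0 := by
    have h1 : μ univ ≠ 0 := Measure.measure_univ_ne_zero.2 hμ
    have h2 : ENNReal.ofReal Real.pi ≠ 0 := (ENNReal.ofReal_pos.2 hpi).ne'
    have h3 : ENNReal.ofReal (Real.pi - -Real.pi) ≠ 0 :=
      (ENNReal.ofReal_pos.2 (by linarith)).ne'
    rw [hc]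
    exact mul_ne_zero h2 (pow_ne_zero 2 (mul_ne_zero (pow_ne_zero 2 h1) h3))
  -- With `|μ̂|` equal to the total mass, the weighted integrand is at least a positive constant on
  -- the whole line.
  have hle : ∫⁻ _ : ℝ, c ≤
      ∫⁻ t, ENNReal.ofReal (Real.pi * (1 + 2 * Real.pi * |t|)) * average X Y μ t ^ 2 := by
    refine lintegral_mono fun t => ?_
    simp only [average, hhat]
    rw [setLIntegral_const, Real.volume_Ioc, hc]
    gcongr
    exact le_mul_of_one_le_right hpi.le (by
      have := mul_nonneg (mul_nonneg zero_le_two hpi.le) (abs_nonneg t)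
      linarith)
  rw [lintegral_const, Real.volume_univ, ENNReal.mul_top hc0, top_le_iff] at hle
  exact hlt.ne hle

end IsNormalAngleParam

/-! ### Conclusion -/

theorem theorem1p2 (K : Set Plane) (hconv : Convex ℝ K) (hbdd : Bornology.IsBounded K)
    (h0 : (0 : Plane) ∈ interior K) (hK : IsSmoothCurvedClosedCurve (frontier K))
    (E : Set Plane) (hE : ∀ x ∈ E, ∀ i, x i ∈ Icc (0 : ℝ) 1)
    (μ : Measure Plane) [IsFiniteMeasure μ] (hμ : μ ≠ 0) (hμE : μ Eᶜ = 0)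
    (hint : mattilaIntegral K μ < ⊤) :
    0 < volume (distanceSet (dualSet K) E) := by
  rw [pos_iff_ne_zero]
  intro hΔ
  obtain ⟨X, Y, ρ, h⟩ := exists_isNormalAngleParam hK
  have hgc : Continuous (gauge (dualSet K)) :=
    continuous_gauge (convex_dualSet K) (dualSet_mem_nhds_zero hbdd)
  have hdc : Continuous fun p : Plane × Plane => gauge (dualSet K) (p.1 - p.2) := by fun_prop
  have hE' : ∀ᵐ x ∂μ, x ∈ E := hμE
  have hEE : ∀ᵐ p ∂(μ.prod μ), p.1 ∈ E ∧ p.2 ∈ E :=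
    (Measure.quasiMeasurePreserving_fst.ae hE').and (Measure.quasiMeasurePreserving_snd.ae hE')
  have hμR : ∀ᵐ p ∂(μ.prod μ), ‖p.1 - p.2‖ ≤ 2 := by
    filter_upwards [hEE] with p hp
    rw [EuclideanSpace.norm_eq, Fin.sum_univ_two]
    refine Real.sqrt_le_iff.2 ⟨zero_le_two, ?_⟩
    have hi : ∀ i, ‖(p.1 - p.2) i‖ ^ 2 ≤ 1 := fun i => by
      have h1 := hE _ hp.1 i
      have h2 := hE _ hp.2 i
      rw [PiLp.sub_apply, Real.norm_eq_abs, sq_abs, sq_le_one_iff_abs_le_one, abs_le]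
      exact ⟨by linarith [h1.1, h2.2], by linarith [h1.2, h2.1]⟩
    linarith [hi 0, hi 1]
  set ν := (μ.prod μ).map fun p => gauge (dualSet K) (p.1 - p.2) with hν
  have hnull : ∀ r : ℝ, 0 < r → ν (Ioi r) = 0 := by
    intro r hr
    obtain ⟨A, ε₀, hε₀, hA⟩ := h.exists_measure_le_sqrt hconv hbdd h0 hint two_pos hμR hr
    have hle : ∀ ε ∈ Ioc 0 ε₀, ν (Ioi r) ≤ ENNReal.ofReal (A * √ε) := by
      intro ε hε
      -- Outer regularity needs no measurability of the distance set. Almost every pair lies in `E ×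
      -- E`, so `ν` is carried by `U`.
      obtain ⟨U, hΔU, hU, hUε⟩ := (distanceSet (dualSet K) E).exists_isOpen_lt_of_lt
        (μ := volume) (ENNReal.ofReal ε) (by rw [hΔ]; exact ENNReal.ofReal_pos.2 hε.1)
      have hUc : ν Uᶜ = 0 := by
        rw [hν, Measure.map_apply hdc.measurable hU.measurableSet.compl]
        refine measure_mono_null ?_ hEE
        intro p hp hpE
        exact hp (hΔU ⟨p.1, hpE.1, p.2, hpE.2, rfl⟩)
      calc ν (Ioi r) ≤ ν (U ∩ Ioi r ∪ Uᶜ) := measure_mono fun t ht => by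
            by_cases htU : t ∈ U
            · exact Or.inl ⟨htU, ht⟩
            · exact Or.inr htU
        _ ≤ ν (U ∩ Ioi r) + ν Uᶜ := measure_union_le _ _
        _ ≤ _ := by
            rw [hUc, add_zero]
            exact hA ε hε.1 hε.2 _ (hU.inter isOpen_Ioi) inter_subset_right
              ((measure_mono inter_subset_left).trans hUε.le)
    have hlim : Filter.Tendsto (fun ε => ENNReal.ofReal (A * √ε)) (nhdsWithin 0 (Ioi 0))
        (nhds 0) := by
      have hc : Continuous fun ε => ENNReal.ofReal (A * √ε) :=
        ENNReal.continuous_ofReal.comp (by fun_prop)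
      have := (hc.tendsto 0).mono_left (nhdsWithin_le_nhds (s := Ioi 0))
      simpa using this
    refine le_antisymm (ge_of_tendsto hlim ?_) zero_le
    filter_upwards [Ioc_mem_nhdsGT hε₀] with ε hε using hle ε hε
  -- The gauge is positive off the origin, so the sets where it exceeds `1 / (n + 1)` exhaust the
  -- complement of the diagonal.
  have hdiag : ∀ᵐ p ∂(μ.prod μ), p.1 = p.2 := by
    have hall : ∀ᵐ p ∂(μ.prod μ), ∀ n : ℕ,
        ¬ 1 / ((n : ℝ) + 1) < gauge (dualSet K) (p.1 - p.2) := by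
      refine ae_all_iff.2 fun n => ?_
      have := hnull (1 / ((n : ℝ) + 1)) Nat.one_div_pos_of_nat
      rw [hν, Measure.map_apply hdc.measurable measurableSet_Ioi] at this
      exact measure_eq_zero_iff_ae_notMem.1 this
    filter_upwards [hall] with p hp
    by_contra hne
    obtain ⟨n, hn⟩ := exists_nat_one_div_lt
      (h.gauge_dualSet_pos hconv h0 (sub_ne_zero.2 hne))
    exact hp n hn
  -- As `μ ≠ 0`, some section of the diagonal has full measure, so `μ` is concentrated at one point.
  have : (ae μ).NeBot := ae_neBot.2 hμ
  obtain ⟨a, ha⟩ := (Measure.ae_ae_of_ae_prod hdiag).exists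
  exact hint.ne (h.mattilaIntegral_eq_top_of_ae_eq hμ ha)
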